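/- For a non-singular matrix $A\in\operatorname{M}_n(\mathbb Z)$ let $G_A=\{A^k\mathbf x \mid \mathbf x\in\mathbb Z^n,\ k\in\mathbb Z\}$, a subgroup of $\mathbb Q^n$ (written as columns). For non-singular $A,B\in\operatorname{M}_n(\mathbb Z)$, a matrix $T\in\operatorname{M}_n(\mathbb Q)$ is called a homomorphism (resp. an isomorphism) from $G_A$ to $G_B$ if $\mathbf x\mapsto T\mathbf x$ defines a group homomorphism (resp. a group isomorphism) $G_A\to G_B$. Every group homomorphism $G_A\to G_B$ is induced in this way by a unique $T\in\operatorname{M}_n(\mathbb Q)$, and accordingly $\operatorname{End}(G_A)$ and $\operatorname{Aut}(G_A)$ are regarded as sets of rational $n\times n$ matrices. A matrix or vector is given to an algorithm as the finite list of its entries, a rational entry as its numerator and denominator in lowest terms. Then the following problems are decidable, each by a single algorithm for all $n$ and all inputs of the stated kind. 1. Given a non-singular $A\in\operatorname{M}_n(\mathbb Z)$ and $\mathbf x\in\mathbb Q^n$, decide whether $\mathbf x\in G_A$. 2. Given a non-singular $A\in\operatorname{M}_n(\mathbb Z)$ and $T\in\operatorname{M}_n(\mathbb Q)$, decide whether $T\in\operatorname{End}(G_A)$.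 3. Given a non-singular $A\in\operatorname{M}_n(\mathbb Z)$ and $T\in\operatorname{M}_n(\mathbb Q)$, decide whether $T\in\operatorname{Aut}(G_A)$. 4. Given non-singular $A,B\in\operatorname{M}_n(\mathbb Z)$ and $T\in\operatorname{M}_n(\mathbb Q)$, decide whether $T$ is a homomorphism from $G_A$ to $G_B$. 5. Given non-singular $A,B\in\operatorname{M}_n(\mathbb Z)$ and $T\in\operatorname{GL}_n(\mathbb Q)$, decide whether $T$ is an isomorphism from $G_A$ to $G_B$. -/

import Mathlib

open scoped Matrix

namespace SolenoidGroup

/-- The rational matrix with the same entries as the integer matrix `A`. -/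
def toRat {n : ℕ} (A : Matrix (Fin n) (Fin n) ℤ) : Matrix (Fin n) (Fin n) ℚ :=
  A.map (fun a => (a : ℚ))

/-- The rational vector with the same entries as the integer vector `x`. -/
def vecToRat {n : ℕ} (x : Fin n → ℤ) : Fin n → ℚ := fun i => (x i : ℚ)

theorem toRat_mulVec {n : ℕ} (A : Matrix (Fin n) (Fin n) ℤ) (x : Fin n → ℤ) :
    toRat A *ᵥ vecToRat x = vecToRat (A *ᵥ x) := by
  ext i
  simp [toRat, vecToRat, Matrix.mulVec, dotProduct]

theorem toRat_pow_mulVec {n : ℕ} (A : Matrix (Fin n) (Fin n) ℤ) (m : ℕ) (x : Fin n → ℤ) :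
    toRat A ^ m *ᵥ vecToRat x = vecToRat (A ^ m *ᵥ x) := by
  induction m with
  | zero => simp
  | succ m ih =>
    rw [pow_succ', pow_succ', ← Matrix.mulVec_mulVec, ih, toRat_mulVec, Matrix.mulVec_mulVec]

theorem isUnit_det_toRat {n : ℕ} {A : Matrix (Fin n) (Fin n) ℤ} (hA : A.det ≠ 0) :
    IsUnit (toRat A).det := by
  have h : (toRat A).det = ((A.det : ℤ) : ℚ) := by
    have := (Int.castRingHom ℚ).map_det A
    simpa [toRat, RingHom.mapMatrix_apply] using this.symm
  rw [h]
  exact isUnit_iff_ne_zero.mpr (by exact_mod_cast hA)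

/-- The set `{A ^ k x | x ∈ ℤⁿ, k ∈ ℤ} ⊆ ℚⁿ`, for an integer matrix `A`. -/
def solSet {n : ℕ} (A : Matrix (Fin n) (Fin n) ℤ) : Set (Fin n → ℚ) :=
  {y | ∃ (k : ℤ) (x : Fin n → ℤ), y = toRat A ^ k *ᵥ vecToRat x}

theorem solSet_lower {n : ℕ} {A : Matrix (Fin n) (Fin n) ℤ} (hA : A.det ≠ 0) {k m : ℤ}
    (h : m ≤ k) (x : Fin n → ℤ) :
    ∃ x' : Fin n → ℤ, toRat A ^ k *ᵥ vecToRat x = toRat A ^ m *ᵥ vecToRat x' := by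
  obtain ⟨d, rfl⟩ := Int.le.dest h
  refine ⟨A ^ d *ᵥ x, ?_⟩
  rw [Matrix.zpow_add (isUnit_det_toRat hA), ← Matrix.mulVec_mulVec, zpow_natCast,
    toRat_pow_mulVec]

theorem solSet_add {n : ℕ} {A : Matrix (Fin n) (Fin n) ℤ} (hA : A.det ≠ 0)
    {y z : Fin n → ℚ} (hy : y ∈ solSet A) (hz : z ∈ solSet A) : y + z ∈ solSet A := by
  obtain ⟨k, x, rfl⟩ := hy
  obtain ⟨l, w, rfl⟩ := hz
  obtain ⟨x', hx⟩ := solSet_lower hA (min_le_left k l) x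
  obtain ⟨w', hw⟩ := solSet_lower hA (min_le_right k l) w
  refine ⟨min k l, x' + w', ?_⟩
  rw [hx, hw, ← Matrix.mulVec_add]
  congr 1
  ext i
  simp [vecToRat]

/-- For a non-singular integer matrix `A`, the subgroup `G_A = {A ^ k x | x ∈ ℤⁿ, k ∈ ℤ}`
of `ℚⁿ`. -/
def solGroup {n : ℕ} (A : Matrix (Fin n) (Fin n) ℤ) (hA : A.det ≠ 0) :
    AddSubgroup (Fin n → ℚ) where
  carrier := solSet A
  zero_mem' := ⟨0, 0, by ext i; simp [vecToRat]⟩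
  add_mem' := solSet_add hA
  neg_mem' := by
    rintro y ⟨k, x, rfl⟩
    refine ⟨k, -x, ?_⟩
    have h : vecToRat (-x) = -vecToRat x := by
      ext i
      simp [vecToRat]
    rw [h, Matrix.mulVec_neg]

theorem vecToRat_mem {n : ℕ} (A : Matrix (Fin n) (Fin n) ℤ) (hA : A.det ≠ 0) (x : Fin n → ℤ) :
    vecToRat x ∈ solGroup A hA :=
  ⟨0, x, by simp⟩

/-- Every group homomorphism `G_A → G_B` is `x ↦ T x` for a unique rational matrix `T`. -/
theorem existsUnique_matrix {n : ℕ} {A B : Matrix (Fin n) (Fin n) ℤ} (hA : A.det ≠ 0)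
    (hB : B.det ≠ 0) (φ : solGroup A hA →+ solGroup B hB) :
    ∃! T : Matrix (Fin n) (Fin n) ℚ, ∀ x : solGroup A hA,
      (φ x : Fin n → ℚ) = T *ᵥ (x : Fin n → ℚ) := by
  classical
  let e : Fin n → solGroup A hA := fun j => ⟨vecToRat (Pi.single j 1), vecToRat_mem A hA _⟩
  have he : ∀ j, (e j : Fin n → ℚ) = Pi.single j 1 := by
    intro j
    ext i
    by_cases h : i = j
    · subst h
      simp [e, vecToRat]
    · simp [e, vecToRat, h]
  refine ⟨Matrix.of fun i j => (φ (e j) : Fin n → ℚ) i, ?_, ?_⟩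
  · intro x
    set T : Matrix (Fin n) (Fin n) ℚ := Matrix.of fun i j => (φ (e j) : Fin n → ℚ) i
    let N : ℕ := ∏ i, ((x : Fin n → ℚ) i).den
    have hN : (N : ℚ) ≠ 0 := by
      have : N ≠ 0 := Finset.prod_ne_zero_iff.mpr fun i _ => ((x : Fin n → ℚ) i).den_nz
      exact_mod_cast this
    have hm : ∀ i, ∃ m : ℤ, (N : ℚ) * (x : Fin n → ℚ) i = m := by
      intro i
      obtain ⟨c, hc⟩ := Finset.dvd_prod_of_mem (fun i => ((x : Fin n → ℚ) i).den)
        (Finset.mem_univ i)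
      refine ⟨c * ((x : Fin n → ℚ) i).num, ?_⟩
      have hd := Rat.den_mul_eq_num ((x : Fin n → ℚ) i)
      have hc' : (N : ℚ) = (((x : Fin n → ℚ) i).den : ℚ) * c := by exact_mod_cast hc
      rw [hc']
      push_cast
      rw [← hd]
      ring
    choose m hm using hm
    have hx : N • x = ∑ j, m j • e j := by
      apply Subtype.ext
      ext i
      simp [he, hm, Pi.single_apply]
    have hφ := congrArg (fun z : solGroup B hB => (z : Fin n → ℚ)) (congrArg φ hx)
    ext i
    have hi := congrFun hφ i
    simp only [map_nsmul, map_sum, map_zsmul, AddSubgroup.coe_nsmul, AddSubgroup.val_finsetSum,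
      AddSubgroup.coe_zsmul, Pi.smul_apply, Finset.sum_apply, nsmul_eq_mul, zsmul_eq_mul] at hi
    apply mul_left_cancel₀ hN
    rw [hi, Matrix.mulVec, dotProduct, Finset.mul_sum]
    refine Finset.sum_congr rfl fun j _ => ?_
    have h1 : T i j = (φ (e j) : Fin n → ℚ) i := rfl
    have h2 : ((m j : Fin n → ℚ) * (φ (e j) : Fin n → ℚ)) i =
        (m j : ℚ) * (φ (e j) : Fin n → ℚ) i := by
      simp
    rw [h2, ← hm j, h1]
    ring
  · intro S hS
    ext i j
    have := congrFun (hS (e j)) i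
    rw [he] at this
    simpa using this.symm

/-- `T` is a homomorphism from `G_A` to `G_B`: the map `x ↦ T x` is (well defined as) a group
homomorphism `G_A → G_B`. -/
def IsHom {n : ℕ} (A B : Matrix (Fin n) (Fin n) ℤ) (hA : A.det ≠ 0) (hB : B.det ≠ 0)
    (T : Matrix (Fin n) (Fin n) ℚ) : Prop :=
  ∃ φ : solGroup A hA →+ solGroup B hB, ∀ x : solGroup A hA,
    (φ x : Fin n → ℚ) = T *ᵥ (x : Fin n → ℚ)

/-- `T` is an isomorphism from `G_A` to `G_B`: the map `x ↦ T x` is (well defined as) a group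
isomorphism `G_A → G_B`. -/
def IsIso {n : ℕ} (A B : Matrix (Fin n) (Fin n) ℤ) (hA : A.det ≠ 0) (hB : B.det ≠ 0)
    (T : Matrix (Fin n) (Fin n) ℚ) : Prop :=
  ∃ φ : solGroup A hA ≃+ solGroup B hB, ∀ x : solGroup A hA,
    (φ x : Fin n → ℚ) = T *ᵥ (x : Fin n → ℚ)

/-- `End(G_A)`, an endomorphism being written as the rational matrix that induces it. -/
def endSet {n : ℕ} (A : Matrix (Fin n) (Fin n) ℤ) (hA : A.det ≠ 0) :
    Set (Matrix (Fin n) (Fin n) ℚ) :=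
  {T | IsHom A A hA hA T}

/-- `Aut(G_A)`, an automorphism being written as the rational matrix that induces it. -/
def autSet {n : ℕ} (A : Matrix (Fin n) (Fin n) ℤ) (hA : A.det ≠ 0) :
    Set (Matrix (Fin n) (Fin n) ℚ) :=
  {T | IsIso A A hA hA T}

/-- An integer matrix as input data of an algorithm: the list of its rows. -/
def intMatCode {n : ℕ} (A : Matrix (Fin n) (Fin n) ℤ) : List (List ℤ) :=
  List.ofFn fun i => List.ofFn fun j => A i j

/-- A rational number as input data: numerator and denominator in lowest terms. -/
def ratCode (q : ℚ) : ℤ × ℕ := (q.num, q.den)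

/-- A rational vector as input data: the list of its entries. -/
def ratVecCode {n : ℕ} (x : Fin n → ℚ) : List (ℤ × ℕ) :=
  List.ofFn fun i => ratCode (x i)

/-- A rational matrix as input data: the list of its rows. -/
def ratMatCode {n : ℕ} (T : Matrix (Fin n) (Fin n) ℚ) : List (List (ℤ × ℕ)) :=
  List.ofFn fun i => List.ofFn fun j => ratCode (T i j)

end SolenoidGroup

namespace SolenoidGroup

/-! ### Integer arithmetic is primitive recursive -/

/-! A vector lies in `G_B` exactly when some power `B ^ l` makes it integral. For a matrix `S / M`
with `S` integral this says that the orbit of `S` under left multiplication by `B` on `n × n`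
matrices over `ZMod M` reaches the fixed point 0. An orbit in a finite set that reaches a fixed
point does so within as many steps as the set has elements, so the single exponent `M ^ (n * n)`
decides membership (`evInt_inv_smul_iff`).

`T` maps `G_A` to `G_B` iff all columns of `T * A⁻¹ ^ k` lie in `G_B` for every `k` (`isHom_iff`). A
failure is witnessed by one `k`. Success has a finite witness too. The integral matrices inducing
homomorphisms form a finitely generated ℤ-module. By the ascending chain condition some map `S ↦ B ^
m * S * A⁻¹` preserves it (`exists_twist_mapsTo`), and this map is a root of a monic integer
polynomial. The polynomial yields a linear recurrence for the matrices `T * A⁻¹ ^ k`, up to powers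
of `B` (`exists_certificate`). Conversely, such a recurrence, together with the case `k = d`, where
`d` is its order, gives all `k` by induction (`evInt_of_certificate`). Searching for both kinds of
witness at once always terminates and decides the homomorphism problem.

An isomorphism is an invertible `T` such that `T` and its inverse are both homomorphisms
(`isIso_iff`). All tests are primitive recursive functions on lists of rows; only the searches are
unbounded. -/

theorem encode_int_sub (a b : ℕ) :
    Encodable.encode ((a : ℤ) - b) = if b ≤ a then 2 * (a - b) else 2 * (b - a) - 1 := by
  -- The integer `c ≥ 0` has code `2 * c`, and `-(c + 1)` has code `2 * c + 1`.
  split_ifs with h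
  · obtain ⟨c, rfl⟩ := Nat.exists_eq_add_of_le h
    have : ((b + c : ℕ) : ℤ) - b = Int.ofNat c := by simp
    rw [this, Nat.add_sub_cancel_left]
    rfl
  · obtain ⟨c, rfl⟩ := Nat.exists_eq_add_of_lt (not_le.mp h)
    have : (a : ℤ) - ((a + c + 1 : ℕ) : ℤ) = Int.negSucc c := by
      rw [Int.negSucc_eq]; push_cast; ring
    rw [this]
    have h2 : 2 * (a + c + 1 - a) - 1 = 2 * c + 1 := by omega
    rw [h2]
    rfl

/-- Integer operations reduce to natural ones through `z = z.toNat - (-z).toNat`; this difference is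
the only place where integer codes have to be produced by hand. -/
theorem primrec_int_sub_nat : Primrec₂ fun a b : ℕ => (a : ℤ) - b := by
  refine Primrec.encode_iff.mp ?_
  have : Primrec fun p : ℕ × ℕ => if p.2 ≤ p.1 then 2 * (p.1 - p.2) else 2 * (p.2 - p.1) - 1 :=
    Primrec.ite (Primrec.nat_le.comp Primrec.snd Primrec.fst)
      (Primrec.nat_double.comp (Primrec.nat_sub.comp Primrec.fst Primrec.snd))
      (Primrec.nat_sub.comp
        (Primrec.nat_double.comp (Primrec.nat_sub.comp Primrec.snd Primrec.fst))
        (Primrec.const 1))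
  exact this.of_eq fun p => (encode_int_sub p.1 p.2).symm

theorem encode_int_ofNat (a : ℕ) : Encodable.encode (Int.ofNat a) = 2 * a := rfl

theorem encode_int_negSucc (a : ℕ) : Encodable.encode (Int.negSucc a) = 2 * a + 1 := rfl

theorem primrec_int_toNat : Primrec Int.toNat := by
  have : Primrec fun z : ℤ => if Encodable.encode z % 2 = 0 then Encodable.encode z / 2 else 0 :=
    Primrec.ite (Primrec.eq.comp (Primrec.nat_mod.comp Primrec.encode (Primrec.const 2))
      (Primrec.const 0)) (Primrec.nat_div.comp Primrec.encode (Primrec.const 2)) (Primrec.const 0)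
  refine this.of_eq fun z => ?_
  cases z with
  | ofNat a => rw [encode_int_ofNat]; simp
  | negSucc a => rw [encode_int_negSucc, if_neg (by omega)]; rfl

theorem primrec_int_neg_toNat : Primrec fun z : ℤ => (-z).toNat := by
  have : Primrec fun z : ℤ =>
      if Encodable.encode z % 2 = 0 then 0 else Encodable.encode z / 2 + 1 :=
    Primrec.ite (Primrec.eq.comp (Primrec.nat_mod.comp Primrec.encode (Primrec.const 2))
      (Primrec.const 0)) (Primrec.const 0)
      (Primrec.succ.comp (Primrec.nat_div.comp Primrec.encode (Primrec.const 2)))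
  refine this.of_eq fun z => ?_
  cases z with
  | ofNat a => rw [encode_int_ofNat]; simp
  | negSucc a =>
    rw [encode_int_negSucc, if_neg (by omega), Int.neg_negSucc]
    simp only [Int.toNat_natCast]
    omega

theorem primrec_int_ofNat : Primrec fun a : ℕ => (a : ℤ) :=
  (primrec_int_sub_nat.comp Primrec.id (Primrec.const 0)).of_eq fun a => by simp

theorem primrec_int_natAbs : Primrec Int.natAbs :=
  (Primrec.nat_add.comp primrec_int_toNat primrec_int_neg_toNat).of_eq fun z => by omega

theorem primrec_int_add : Primrec₂ fun a b : ℤ => a + b :=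
  (primrec_int_sub_nat.comp
    (Primrec.nat_add.comp (primrec_int_toNat.comp Primrec.fst)
      (primrec_int_toNat.comp Primrec.snd))
    (Primrec.nat_add.comp (primrec_int_neg_toNat.comp Primrec.fst)
      (primrec_int_neg_toNat.comp Primrec.snd))).of_eq fun p => by
    change _ = p.1 + p.2
    omega

theorem primrec_int_mul : Primrec₂ fun a b : ℤ => a * b :=
  (primrec_int_sub_nat.comp
    (Primrec.nat_add.comp
      (Primrec.nat_mul.comp (primrec_int_toNat.comp Primrec.fst)
        (primrec_int_toNat.comp Primrec.snd))
      (Primrec.nat_mul.comp (primrec_int_neg_toNat.comp Primrec.fst)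
        (primrec_int_neg_toNat.comp Primrec.snd)))
    (Primrec.nat_add.comp
      (Primrec.nat_mul.comp (primrec_int_toNat.comp Primrec.fst)
        (primrec_int_neg_toNat.comp Primrec.snd))
      (Primrec.nat_mul.comp (primrec_int_neg_toNat.comp Primrec.fst)
        (primrec_int_toNat.comp Primrec.snd)))).of_eq fun p => by
    have h1 : p.1 = (p.1.toNat : ℤ) - ((-p.1).toNat : ℤ) := by omega
    have h2 : p.2 = (p.2.toNat : ℤ) - ((-p.2).toNat : ℤ) := by omega
    conv_rhs => rw [h1, h2]
    push_cast
    ring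

/-! ### Finite sums and products of primitive recursive functions -/

section Sums

variable {α : Type*} [Primcodable α]

theorem primrec_sum {n : α → ℕ} {g : α → ℕ → ℤ} (hn : Primrec n) (hg : Primrec₂ g) :
    Primrec fun a => ∑ k ∈ Finset.range (n a), g a k := by
  have : Primrec fun a => Nat.rec (motive := fun _ => ℤ) 0 (fun k s => s + g a k) (n a) :=
    Primrec.nat_rec' (h := fun a (p : ℕ × ℤ) => p.2 + g a p.1) hn (Primrec.const 0)
      (primrec_int_add.comp (Primrec.snd.comp Primrec.snd)
        (hg.comp Primrec.fst (Primrec.fst.comp Primrec.snd)))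
  refine this.of_eq fun a => ?_
  induction n a with
  | zero => rfl
  | succ k ih => rw [Finset.sum_range_succ, ← ih]

theorem primrec_prod {n : α → ℕ} {g : α → ℕ → ℕ} (hn : Primrec n) (hg : Primrec₂ g) :
    Primrec fun a => ∏ k ∈ Finset.range (n a), g a k := by
  have : Primrec fun a => Nat.rec (motive := fun _ => ℕ) 1 (fun k s => s * g a k) (n a) :=
    Primrec.nat_rec' (h := fun a (p : ℕ × ℕ) => p.2 * g a p.1) hn (Primrec.const 1)
      (Primrec.nat_mul.comp (Primrec.snd.comp Primrec.snd)
        (hg.comp Primrec.fst (Primrec.fst.comp Primrec.snd)))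
  refine this.of_eq fun a => ?_
  induction n a with
  | zero => rfl
  | succ k ih => rw [Finset.prod_range_succ, ← ih]

theorem primrec_nat_pow : Primrec₂ fun a b : ℕ => a ^ b := by
  have : Primrec fun p : ℕ × ℕ => ∏ _k ∈ Finset.range p.2, p.1 :=
    primrec_prod Primrec.snd (Primrec.fst.comp Primrec.fst)
  exact this.of_eq fun p => by simp

end Sums

/-! ### Matrices as lists of rows -/

/-- The entry of a list of rows, zero outside its range. -/
def entry (L : List (List ℤ)) (i j : ℕ) : ℤ := (L.getD i []).getD j 0

/-- The list of rows of the `n × n` matrix with entries `f i j`. -/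
def tab (n : ℕ) (f : ℕ → ℕ → ℤ) : List (List ℤ) :=
  (List.range n).map fun i => (List.range n).map (f i)

/-- The `n × n` matrix with the given list of rows. -/
def toMat (n : ℕ) (L : List (List ℤ)) : Matrix (Fin n) (Fin n) ℤ := fun i j => entry L i j

theorem entry_tab {n : ℕ} (f : ℕ → ℕ → ℤ) {i j : ℕ} (hi : i < n) (hj : j < n) :
    entry (tab n f) i j = f i j := by
  simp [entry, tab, List.getD_eq_getElem?_getD, hi, hj]

theorem toMat_tab (n : ℕ) (f : ℕ → ℕ → ℤ) : toMat n (tab n f) = Matrix.of fun i j : Fin n => f i j := by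
  ext i j
  exact entry_tab f i.2 j.2

theorem toMat_intMatCode {n : ℕ} (A : Matrix (Fin n) (Fin n) ℤ) :
    toMat n (intMatCode A) = A := by
  ext i j
  simp [toMat, entry, intMatCode, List.getD_eq_getElem?_getD]

/-- The product of matrices given as lists of rows. -/
def lmul (n : ℕ) (L M : List (List ℤ)) : List (List ℤ) :=
  tab n fun i j => ∑ k ∈ Finset.range n, entry L i k * entry M k j

/-- The power of a matrix given as a list of rows. -/
def lpow (n : ℕ) (L : List (List ℤ)) (k : ℕ) : List (List ℤ) :=
  Nat.rec (tab n fun i j => if i = j then 1 else 0) (fun _ P => lmul n L P) k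

/-- The integer multiple of a matrix given as a list of rows. -/
def lsmul (n : ℕ) (c : ℤ) (L : List (List ℤ)) : List (List ℤ) :=
  tab n fun i j => c * entry L i j

theorem toMat_lmul (n : ℕ) (L M : List (List ℤ)) :
    toMat n (lmul n L M) = toMat n L * toMat n M := by
  rw [lmul, toMat_tab]
  ext i j
  rw [Matrix.mul_apply, Matrix.of_apply, Finset.sum_range]
  rfl

theorem toMat_lpow (n : ℕ) (L : List (List ℤ)) (k : ℕ) :
    toMat n (lpow n L k) = toMat n L ^ k := by
  induction k with
  | zero =>
    change toMat n (tab n _) = _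
    rw [pow_zero, toMat_tab]
    ext i j
    simp [Matrix.one_apply, Fin.ext_iff]
  | succ k ih => rw [pow_succ', ← ih, ← toMat_lmul]; rfl

theorem toMat_lsmul (n : ℕ) (c : ℤ) (L : List (List ℤ)) :
    toMat n (lsmul n c L) = c • toMat n L := by
  rw [lsmul, toMat_tab]
  rfl

section Primrec

variable {α : Type*} [Primcodable α]

theorem primrec_entry {L : α → List (List ℤ)} {i j : α → ℕ} (hL : Primrec L) (hi : Primrec i)
    (hj : Primrec j) : Primrec fun a => entry (L a) (i a) (j a) :=
  (Primrec.list_getD 0).comp ((Primrec.list_getD []).comp hL hi) hj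

theorem primrec_tab {n : α → ℕ} {f : α → ℕ → ℕ → ℤ} (hn : Primrec n)
    (hf : Primrec fun p : (α × ℕ) × ℕ => f p.1.1 p.1.2 p.2) :
    Primrec fun a => tab (n a) (f a) :=
  Primrec.list_map (g := fun a i => (List.range (n a)).map (f a i))
    (Primrec.list_range.comp hn)
    (Primrec.list_map (f := fun p : α × ℕ => List.range (n p.1))
      (g := fun (p : α × ℕ) j => f p.1 p.2 j)
      (Primrec.list_range.comp (hn.comp Primrec.fst)) hf)

theorem primrec_lmul {n : α → ℕ} {L M : α → List (List ℤ)} (hn : Primrec n) (hL : Primrec L)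
    (hM : Primrec M) : Primrec fun a => lmul (n a) (L a) (M a) := by
  refine primrec_tab hn (primrec_sum (g := fun (p : (α × ℕ) × ℕ) k =>
    entry (L p.1.1) p.1.2 k * entry (M p.1.1) k p.2)
    (hn.comp (Primrec.fst.comp Primrec.fst)) (primrec_int_mul.comp ?_ ?_))
  · exact primrec_entry (hL.comp (Primrec.fst.comp (Primrec.fst.comp Primrec.fst)))
      (Primrec.snd.comp (Primrec.fst.comp Primrec.fst)) Primrec.snd
  · exact primrec_entry (hM.comp (Primrec.fst.comp (Primrec.fst.comp Primrec.fst)))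
      Primrec.snd (Primrec.snd.comp Primrec.fst)

theorem primrec_lpow {n k : α → ℕ} {L : α → List (List ℤ)} (hn : Primrec n) (hL : Primrec L)
    (hk : Primrec k) : Primrec fun a => lpow (n a) (L a) (k a) := by
  refine Primrec.nat_rec' (h := fun a (p : ℕ × List (List ℤ)) => lmul (n a) (L a) p.2) hk
    (primrec_tab (f := fun _ i j => if i = j then 1 else 0) hn ?_) ?_
  · exact Primrec.ite (Primrec.eq.comp (Primrec.snd.comp Primrec.fst) Primrec.snd)
      (Primrec.const 1) (Primrec.const 0)
  · exact primrec_lmul (hn.comp Primrec.fst) (hL.comp Primrec.fst)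
      (Primrec.snd.comp Primrec.snd)

theorem primrec_lsmul {n : α → ℕ} {c : α → ℤ} {L : α → List (List ℤ)} (hn : Primrec n)
    (hc : Primrec c) (hL : Primrec L) : Primrec fun a => lsmul (n a) (c a) (L a) := by
  refine primrec_tab (f := fun a i j => c a * entry (L a) i j) hn (primrec_int_mul.comp ?_ ?_)
  · exact hc.comp (Primrec.fst.comp Primrec.fst)
  · exact primrec_entry (hL.comp (Primrec.fst.comp Primrec.fst))
      (Primrec.snd.comp Primrec.fst) Primrec.snd

end Primrec

/-- Whether all entries of the matrix with rows `L` are divisible by `M`. -/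
def dvdTest (n M : ℕ) (L : List (List ℤ)) : Bool :=
  decide (∑ i ∈ Finset.range n, ∑ j ∈ Finset.range n, (((entry L i j).natAbs % M : ℕ) : ℤ) = 0)

/-- The residues are nonnegative, so their sum vanishes only if each does: one sum replaces a
bounded double quantifier. -/
theorem dvdTest_iff (n M : ℕ) (L : List (List ℤ)) :
    dvdTest n M L = true ↔ ∃ Y : Matrix (Fin n) (Fin n) ℤ, toMat n L = (M : ℤ) • Y := by
  rw [dvdTest, decide_eq_true_iff, Finset.sum_eq_zero_iff_of_nonneg fun i _ =>
    Finset.sum_nonneg fun j _ => Int.natCast_nonneg _]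
  have key : ∀ z : ℤ, ((z.natAbs % M : ℕ) : ℤ) = 0 ↔ (M : ℤ) ∣ z := fun z => by
    rw [Int.natCast_eq_zero, ← Nat.dvd_iff_mod_eq_zero, Int.natCast_dvd]
  constructor
  · intro h
    have h' : ∀ i j : Fin n, (M : ℤ) ∣ toMat n L i j := fun i j => by
      have hi := h i (Finset.mem_range.mpr i.2)
      rw [Finset.sum_eq_zero_iff_of_nonneg fun j _ => Int.natCast_nonneg _] at hi
      exact (key _).mp (hi j (Finset.mem_range.mpr j.2))
    choose Y hY using h'
    exact ⟨Y, Matrix.ext hY⟩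
  · rintro ⟨Y, hY⟩ i hi
    refine Finset.sum_eq_zero fun j hj => (key _).mpr ?_
    rw [Finset.mem_range] at hi hj
    exact ⟨Y ⟨i, hi⟩ ⟨j, hj⟩, congrFun (congrFun hY ⟨i, hi⟩) ⟨j, hj⟩⟩

/-- Only 0 is divisible by 0, so modulus 0 turns the divisibility test into a test for the zero
matrix. -/
theorem dvdTest_zero_iff (n : ℕ) (L : List (List ℤ)) :
    dvdTest n 0 L = true ↔ toMat n L = 0 := by
  simp [dvdTest_iff]

theorem primrec_dvdTest {α : Type*} [Primcodable α] {n M : α → ℕ} {L : α → List (List ℤ)}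
    (hn : Primrec n) (hM : Primrec M) (hL : Primrec L) :
    Primrec fun a => dvdTest (n a) (M a) (L a) := by
  refine (PrimrecRel.comp Primrec.eq (primrec_sum (g := fun a i => ∑ j ∈ Finset.range (n a),
    (((entry (L a) i j).natAbs % M a : ℕ) : ℤ)) hn (primrec_sum (g := fun (p : α × ℕ) j =>
    (((entry (L p.1) p.2 j).natAbs % M p.1 : ℕ) : ℤ)) (hn.comp Primrec.fst) ?_))
    (Primrec.const 0)).decide
  refine primrec_int_ofNat.comp (Primrec.nat_mod.comp (primrec_int_natAbs.comp ?_) ?_)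
  · exact primrec_entry (hL.comp (Primrec.fst.comp Primrec.fst))
      (Primrec.snd.comp Primrec.fst) Primrec.snd
  · exact hM.comp (Primrec.fst.comp Primrec.fst)

/-! ### Unbounded search -/

/-- A computable test that succeeds somewhere for every input has a computable witness. -/
theorem exists_computable_search {α γ : Type*} [Primcodable α] [Primcodable γ]
    (p : α → γ → Bool) (hp : Computable₂ p) (h : ∀ a, ∃ c, p a c = true) :
    ∃ f : α → γ, Computable f ∧ ∀ a, p a (f a) = true := by
  classical
  -- Candidates are searched through their codes; a number that codes nothing counts as a failure.
  let q : α → ℕ → Bool := fun a k => ((Encodable.decode (α := γ) k).map (p a)).getD false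
  have hq : Computable₂ q :=
    Computable.option_getD (Computable.option_map (g := fun (x : α × ℕ) c => p x.1 c)
      (Computable.decode.comp Computable.snd)
      (hp.comp (Computable.fst.comp Computable.fst) Computable.snd)) (Computable.const false)
  have hex : ∀ a, ∃ k, q a k = true := fun a => by
    obtain ⟨c, hc⟩ := h a
    exact ⟨Encodable.encode c, by simp [q, hc]⟩
  have hfind : Computable fun a => Nat.find (hex a) := by
    have := Partrec.rfind (p := fun a k => Part.some (q a k)) hq.partrec₂
    refine this.of_eq_tot fun a => ?_
    refine Nat.mem_rfind.mpr ⟨by simpa using (Nat.find_spec (hex a)).symm, fun {m} hm => ?_⟩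
    have := Nat.find_min (hex a) hm
    simpa using this
  have hdec : ∀ a, ∃ c, Encodable.decode (α := γ) (Nat.find (hex a)) = some c ∧
      p a c = true := fun a => by
    have := Nat.find_spec (hex a)
    simp only [q] at this
    cases hd : Encodable.decode (α := γ) (Nat.find (hex a)) with
    | none => simp [hd] at this
    | some c => exact ⟨c, rfl, by simpa [hd] using this⟩
  choose f hf using hdec
  refine ⟨f, ?_, fun a => (hf a).2⟩
  exact Computable.option_some_iff.mp
    ((Computable.decode.comp hfind).of_eq fun a => (hf a).1)

/-! ### Rational matrices that become integral -/

section Lattice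

variable {n : ℕ}

theorem toRat_eq (A : Matrix (Fin n) (Fin n) ℤ) :
    toRat A = (Int.castRingHom ℚ).mapMatrix A := rfl

theorem toRat_mul (A B : Matrix (Fin n) (Fin n) ℤ) : toRat (A * B) = toRat A * toRat B := by
  simp only [toRat_eq, map_mul]

theorem toRat_pow (A : Matrix (Fin n) (Fin n) ℤ) (k : ℕ) : toRat (A ^ k) = toRat A ^ k := by
  simp only [toRat_eq, map_pow]

theorem toRat_add (A B : Matrix (Fin n) (Fin n) ℤ) : toRat (A + B) = toRat A + toRat B := by
  simp only [toRat_eq, map_add]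

theorem toRat_zsmul (c : ℤ) (A : Matrix (Fin n) (Fin n) ℤ) : toRat (c • A) = c • toRat A := by
  simp only [toRat_eq, map_zsmul]

theorem toRat_zero : toRat (0 : Matrix (Fin n) (Fin n) ℤ) = 0 := by
  simp only [toRat_eq, map_zero]

theorem toRat_one : toRat (1 : Matrix (Fin n) (Fin n) ℤ) = 1 := by
  simp only [toRat_eq, map_one]

theorem toRat_sum {ι : Type*} (s : Finset ι) (f : ι → Matrix (Fin n) (Fin n) ℤ) :
    toRat (∑ i ∈ s, f i) = ∑ i ∈ s, toRat (f i) := by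
  simp only [toRat_eq, map_sum]

theorem toRat_injective : Function.Injective (toRat (n := n)) := fun A B h => by
  ext i j
  have := congrFun (congrFun h i) j
  simpa [toRat] using this

theorem toRat_mul_inv {A : Matrix (Fin n) (Fin n) ℤ} (hA : A.det ≠ 0) :
    toRat A * (toRat A)⁻¹ = 1 := Matrix.mul_nonsing_inv _ (isUnit_det_toRat hA)

theorem toRat_inv_mul {A : Matrix (Fin n) (Fin n) ℤ} (hA : A.det ≠ 0) :
    (toRat A)⁻¹ * toRat A = 1 := Matrix.nonsing_inv_mul _ (isUnit_det_toRat hA)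

theorem inv_pow_mul_pow {A : Matrix (Fin n) (Fin n) ℤ} (hA : A.det ≠ 0) (k : ℕ) :
    (toRat A)⁻¹ ^ k * toRat A ^ k = 1 := by
  rw [← (show Commute (toRat A)⁻¹ (toRat A) by
    rw [Commute, SemiconjBy, toRat_mul_inv hA, toRat_inv_mul hA]).mul_pow, toRat_inv_mul hA,
    one_pow]

theorem pow_mul_inv_pow {A : Matrix (Fin n) (Fin n) ℤ} (hA : A.det ≠ 0) (k : ℕ) :
    toRat A ^ k * (toRat A)⁻¹ ^ k = 1 := mul_eq_one_comm.mp (inv_pow_mul_pow hA k)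

/-- `B ^ l * S` is integral for some `l`, that is, the columns of `S` lie in `G_B`. -/
def EvInt (B : Matrix (Fin n) (Fin n) ℤ) (S : Matrix (Fin n) (Fin n) ℚ) : Prop :=
  ∃ (l : ℕ) (Y : Matrix (Fin n) (Fin n) ℤ), toRat B ^ l * S = toRat Y

variable {A B : Matrix (Fin n) (Fin n) ℤ} {S T : Matrix (Fin n) (Fin n) ℚ}

theorem integral_pow_mono {l m : ℕ} (hlm : l ≤ m)
    (h : ∃ Y : Matrix (Fin n) (Fin n) ℤ, toRat B ^ l * S = toRat Y) :
    ∃ Y : Matrix (Fin n) (Fin n) ℤ, toRat B ^ m * S = toRat Y := by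
  obtain ⟨Y, hY⟩ := h
  refine ⟨B ^ (m - l) * Y, ?_⟩
  rw [toRat_mul, toRat_pow, ← hY, ← mul_assoc, ← pow_add, Nat.sub_add_cancel hlm]

theorem EvInt.zero : EvInt B 0 := ⟨0, 0, by rw [mul_zero, toRat_zero]⟩

theorem EvInt.add (hS : EvInt B S) (hT : EvInt B T) : EvInt B (S + T) := by
  obtain ⟨l, hl⟩ := hS
  obtain ⟨m, hm⟩ := hT
  obtain ⟨Y, hY⟩ := integral_pow_mono (le_max_left l m) hl
  obtain ⟨Z, hZ⟩ := integral_pow_mono (le_max_right l m) hm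
  exact ⟨max l m, Y + Z, by rw [mul_add, hY, hZ, toRat_add]⟩

theorem EvInt.zsmul (hS : EvInt B S) (c : ℤ) : EvInt B (c • S) := by
  obtain ⟨l, Y, hY⟩ := hS
  exact ⟨l, c • Y, by rw [mul_smul_comm, hY, toRat_zsmul]⟩

theorem EvInt.sum {ι : Type*} {s : Finset ι} {f : ι → Matrix (Fin n) (Fin n) ℚ}
    (h : ∀ i ∈ s, EvInt B (f i)) : EvInt B (∑ i ∈ s, f i) :=
  Finset.sum_induction f (EvInt B) (fun _ _ => EvInt.add) EvInt.zero h

theorem EvInt.mul_toRat (hS : EvInt B S) (Z : Matrix (Fin n) (Fin n) ℤ) :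
    EvInt B (S * toRat Z) := by
  obtain ⟨l, Y, hY⟩ := hS
  exact ⟨l, Y * Z, by rw [← mul_assoc, hY, toRat_mul]⟩

theorem EvInt.pow_mul (hS : EvInt B S) (m : ℕ) : EvInt B (toRat B ^ m * S) := by
  obtain ⟨l, Y, hY⟩ := hS
  refine ⟨l, B ^ m * Y, ?_⟩
  rw [← mul_assoc, ← pow_add, add_comm, pow_add, mul_assoc, hY, toRat_mul, toRat_pow]

theorem EvInt.of_pow_mul {m : ℕ} (hS : EvInt B (toRat B ^ m * S)) : EvInt B S := by
  obtain ⟨l, Y, hY⟩ := hS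
  exact ⟨l + m, Y, by rw [pow_add, mul_assoc, hY]⟩

/-- A finite certificate that `T` maps `G_A` to `G_B` is correct. -/
theorem evInt_of_certificate (hA : A.det ≠ 0) {d m : ℕ} (c : ℕ → ℤ)
    (hd : EvInt B (T * (toRat A)⁻¹ ^ d))
    (hc : toRat B ^ (m * d) * T + ∑ i ∈ Finset.range d,
      c i • (toRat B ^ (m * i) * T * toRat A ^ (d - i)) = 0) (k : ℕ) :
    EvInt B (T * (toRat A)⁻¹ ^ k) := by
  induction k using Nat.strong_induction_on with
  | _ k ih =>
    -- For `k ≤ d`, `T * A⁻¹ ^ k` is `T * A⁻¹ ^ d` times the integral matrix `A ^ (d - k)`.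
    rcases le_or_gt k d with hk | hk
    · obtain ⟨e, rfl⟩ := Nat.exists_eq_add_of_le hk
      have := hd.mul_toRat (A ^ e)
      rwa [pow_add, toRat_pow, mul_assoc, mul_assoc, inv_pow_mul_pow hA, mul_one] at this
    · obtain ⟨e, rfl⟩ := Nat.exists_eq_add_of_le hk.le
      refine EvInt.of_pow_mul (m := m * d) ?_
      -- The recurrence times `A⁻¹ ^ (d + e)` on the right: only the smaller exponents `i + e`
      -- remain, to which the induction hypothesis applies.
      have key : toRat B ^ (m * d) * (T * (toRat A)⁻¹ ^ (d + e)) = ∑ i ∈ Finset.range d,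
          (-c i) • (toRat B ^ (m * i) * (T * (toRat A)⁻¹ ^ (i + e))) := by
        have h := congrArg (· * (toRat A)⁻¹ ^ (d + e)) hc
        simp only [add_mul, zero_mul, Finset.sum_mul] at h
        rw [← mul_assoc, eq_neg_of_add_eq_zero_left h, ← Finset.sum_neg_distrib]
        refine Finset.sum_congr rfl fun i hi => ?_
        have hi' : d + e = (d - i) + (i + e) := by
          have := Finset.mem_range.mp hi
          omega
        rw [smul_mul_assoc, neg_smul, hi', pow_add _ (d - i) (i + e),
          mul_assoc _ (toRat A ^ (d - i)), ← mul_assoc (toRat A ^ (d - i)), pow_mul_inv_pow hA,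
          one_mul, mul_assoc]
      rw [key]
      refine EvInt.sum fun i hi => EvInt.zsmul (EvInt.pow_mul (ih _ ?_) _) _
      have := Finset.mem_range.mp hi
      omega

/-- Integral matrices that induce homomorphisms from `G_A` to `G_B`. -/
def homLattice (A B : Matrix (Fin n) (Fin n) ℤ) : Submodule ℤ (Matrix (Fin n) (Fin n) ℚ) where
  carrier := {S | (∃ Y, S = toRat Y) ∧ ∀ k : ℕ, EvInt B (S * (toRat A)⁻¹ ^ k)}
  zero_mem' := ⟨⟨0, toRat_zero.symm⟩, fun k => by rw [zero_mul]; exact EvInt.zero⟩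
  add_mem' := by
    rintro S T ⟨⟨Y, rfl⟩, hS⟩ ⟨⟨Z, rfl⟩, hT⟩
    exact ⟨⟨Y + Z, (toRat_add _ _).symm⟩, fun k => by rw [add_mul]; exact (hS k).add (hT k)⟩
  smul_mem' := by
    rintro c S ⟨⟨Y, rfl⟩, hS⟩
    exact ⟨⟨c • Y, (toRat_zsmul _ _).symm⟩,
      fun k => by rw [smul_mul_assoc]; exact (hS k).zsmul c⟩

/-- The embedding of integer matrices into rational ones, as a linear map. -/
def toRatLinear (n : ℕ) : Matrix (Fin n) (Fin n) ℤ →ₗ[ℤ] Matrix (Fin n) (Fin n) ℚ :=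
  (Int.castRingHom ℚ).mapMatrix.toAddMonoidHom.toIntLinearMap

/-- All its elements are integral, so it is the image of a submodule of the Noetherian ℤ-module of
integer matrices. -/
theorem homLattice_finite (A B : Matrix (Fin n) (Fin n) ℤ) :
    Module.Finite ℤ (homLattice A B) := by
  have h : homLattice A B = ((homLattice A B).comap (toRatLinear n)).map (toRatLinear n) := by
    rw [Submodule.map_comap_eq, eq_comm, inf_eq_right]
    rintro S ⟨⟨Y, rfl⟩, -⟩
    exact ⟨Y, rfl⟩
  rw [Module.Finite.iff_fg, h]
  exact (IsNoetherian.noetherian _).map _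

/-- The map `S ↦ B ^ m * S * A⁻¹`. -/
noncomputable def twist (A B : Matrix (Fin n) (Fin n) ℤ) (m : ℕ) :
    Module.End ℤ (Matrix (Fin n) (Fin n) ℚ) where
  toFun S := toRat B ^ m * S * (toRat A)⁻¹
  map_add' S T := by rw [mul_add, add_mul]
  map_smul' c S := by rw [mul_smul_comm, smul_mul_assoc, RingHom.id_apply]

theorem twist_pow_apply (A B : Matrix (Fin n) (Fin n) ℤ) (m i : ℕ)
    (S : Matrix (Fin n) (Fin n) ℚ) :
    (twist A B m ^ i) S = toRat B ^ (m * i) * S * (toRat A)⁻¹ ^ i := by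
  induction i with
  | zero => simp
  | succ i ih =>
    rw [pow_succ', Module.End.mul_apply, ih]
    change toRat B ^ m * (toRat B ^ (m * i) * S * (toRat A)⁻¹ ^ i) * (toRat A)⁻¹ = _
    rw [Nat.mul_succ, add_comm, pow_add, pow_succ]
    simp only [mul_assoc]

/-- For each `S` in the lattice some power of `B` makes `S * A⁻¹` integral; the ascending chain
condition makes the exponent uniform in `S`. -/
theorem exists_twist_mapsTo (A B : Matrix (Fin n) (Fin n) ℤ) :
    ∃ m, ∀ S ∈ homLattice A B, twist A B m S ∈ homLattice A B := by
  -- `Q m` consists of the integral `S` with `B ^ m * S * A⁻¹` integral; it grows with `m`.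
  let Q : ℕ →o Submodule ℤ (Matrix (Fin n) (Fin n) ℤ) :=
    { toFun := fun m => (LinearMap.range (toRatLinear n)).comap (twist A B m ∘ₗ toRatLinear n)
      monotone' := by
        rintro l m hlm S ⟨Y, hY⟩
        have hY' : toRat B ^ l * (toRat S * (toRat A)⁻¹) = toRat Y := by
          rw [← mul_assoc]; exact hY.symm
        obtain ⟨Z, hZ⟩ := integral_pow_mono hlm ⟨Y, hY'⟩
        refine ⟨Z, ?_⟩
        rw [← mul_assoc] at hZ
        exact hZ.symm }
  obtain ⟨m, hm⟩ := monotone_stabilizes_iff_noetherian.mpr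
    (inferInstance : IsNoetherian ℤ (Matrix (Fin n) (Fin n) ℤ)) Q
  refine ⟨m, ?_⟩
  rintro S ⟨⟨X, rfl⟩, hS⟩
  constructor
  · obtain ⟨l, Y, hY⟩ := hS 1
    rw [pow_one, ← mul_assoc] at hY
    have h1 : X ∈ Q l := ⟨Y, hY.symm⟩
    have h2 : X ∈ Q m := by
      rw [hm (max m l) (le_max_left m l)]
      exact Q.monotone (le_max_right m l) h1
    obtain ⟨Z, hZ⟩ := h2
    exact ⟨Z, hZ.symm⟩
  · intro k
    have := (hS (k + 1)).pow_mul m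
    change EvInt B (toRat B ^ m * toRat X * (toRat A)⁻¹ * (toRat A)⁻¹ ^ k)
    rwa [pow_succ', ← mul_assoc, ← mul_assoc] at this

/-- A certificate exists for every homomorphism. -/
theorem exists_certificate (hA : A.det ≠ 0) (X : Matrix (Fin n) (Fin n) ℤ)
    (hX : ∀ k, EvInt B (toRat X * (toRat A)⁻¹ ^ k)) :
    ∃ (m d : ℕ) (c : ℕ → ℤ), B ^ (m * d) * X + ∑ i ∈ Finset.range d,
      c i • (B ^ (m * i) * X * A ^ (d - i)) = 0 := by
  obtain ⟨m, hm⟩ := exists_twist_mapsTo A B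
  have := homLattice_finite A B
  -- Cayley–Hamilton for the twist on the finitely generated lattice. Its monic polynomial,
  -- evaluated at `X`, supplies both `d` and the coefficients.
  obtain ⟨p, hp, hp0⟩ := LinearMap.exists_monic_and_aeval_eq_zero ℤ
    ((twist A B m).restrict hm)
  refine ⟨m, p.natDegree, p.coeff, toRat_injective ?_⟩
  have hmem : toRat X ∈ homLattice A B := ⟨⟨X, rfl⟩, hX⟩
  have h := congrArg Subtype.val (LinearMap.congr_fun hp0 ⟨toRat X, hmem⟩)
  have hval : ∀ i, ((((twist A B m).restrict hm ^ i) ⟨toRat X, hmem⟩ : homLattice A B) :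
      Matrix (Fin n) (Fin n) ℚ) = toRat B ^ (m * i) * toRat X * (toRat A)⁻¹ ^ i := fun i => by
    rw [Module.End.pow_restrict, ← twist_pow_apply]
    rfl
  rw [hp.as_sum] at h
  simp only [map_add, map_sum, map_mul, map_pow, Polynomial.aeval_X, Polynomial.aeval_C,
    LinearMap.add_apply, LinearMap.sum_apply, Module.End.mul_apply, Module.algebraMap_end_apply,
    Submodule.coe_add, AddSubmonoidClass.coe_finsetSum, Submodule.coe_smul, hval,
    LinearMap.zero_apply,
    ZeroMemClass.coe_zero] at h
  -- Clears the inverse powers of `A`, leaving an identity between integer matrices that can be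
  -- checked.
  have h' := congrArg (· * toRat A ^ p.natDegree) h
  simp only [add_mul, zero_mul, Finset.sum_mul] at h'
  rw [toRat_zero, ← h', toRat_add, toRat_sum]
  congr 1
  · rw [mul_assoc, inv_pow_mul_pow hA, mul_one, toRat_mul, toRat_pow]
  · refine Finset.sum_congr rfl fun i hi => ?_
    obtain ⟨e, he⟩ := Nat.exists_eq_add_of_le (Finset.mem_range.mp hi).le
    rw [toRat_zsmul, toRat_mul, toRat_mul, toRat_pow, toRat_pow, smul_mul_assoc, he,
      Nat.add_sub_cancel_left, pow_add, ← mul_assoc, mul_assoc _ ((toRat A)⁻¹ ^ i),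
      inv_pow_mul_pow hA, mul_one]

end Lattice

/-! ### Homomorphisms in terms of matrices -/

section Hom

variable {n : ℕ} {A B : Matrix (Fin n) (Fin n) ℤ}

/-- Since `A` is integral, the exponent `k` may be lowered to `-|k|`, so the group is the union of
the lattices `A⁻¹ ^ l ℤⁿ`. -/
theorem mem_solGroup_iff (hA : A.det ≠ 0) {y : Fin n → ℚ} :
    y ∈ solGroup A hA ↔ ∃ (l : ℕ) (x : Fin n → ℤ), toRat A ^ l *ᵥ y = vecToRat x := by
  constructor
  · rintro ⟨k, x, rfl⟩
    obtain ⟨x', hx'⟩ := solSet_lower hA (show -(k.natAbs : ℤ) ≤ k by omega) x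
    refine ⟨k.natAbs, x', ?_⟩
    rw [hx', ← zpow_natCast, Matrix.mulVec_mulVec, ← Matrix.zpow_add (isUnit_det_toRat hA)]
    simp
  · rintro ⟨l, x, h⟩
    refine ⟨-(l : ℤ), x, ?_⟩
    rw [← h, ← zpow_natCast, Matrix.mulVec_mulVec, ← Matrix.zpow_add (isUnit_det_toRat hA)]
    simp

theorem evInt_iff (hB : B.det ≠ 0) (S : Matrix (Fin n) (Fin n) ℚ) :
    EvInt B S ↔ ∀ j, (fun i => S i j) ∈ solGroup B hB := by
  simp only [mem_solGroup_iff]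
  constructor
  · rintro ⟨l, Y, hY⟩ j
    exact ⟨l, fun i => Y i j, funext fun i => congrFun (congrFun hY i) j⟩
  · intro h
    choose l x hx using h
    -- The largest of the exponents of the columns serves for all columns at once.
    have : ∀ j, ∃ x : Fin n → ℤ,
        toRat B ^ (Finset.univ.sup l) *ᵥ (fun i => S i j) = vecToRat x := fun j => by
      obtain ⟨e, he⟩ := Nat.exists_eq_add_of_le (Finset.le_sup (f := l) (Finset.mem_univ j))
      refine ⟨B ^ e *ᵥ x j, ?_⟩
      rw [he, add_comm, pow_add, ← Matrix.mulVec_mulVec, hx, toRat_pow_mulVec]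
    choose y hy using this
    refine ⟨Finset.univ.sup l, Matrix.of fun i j => y j i, ?_⟩
    ext i j
    exact congrFun (hy j) i

theorem evInt_iff_mulVec (hB : B.det ≠ 0) (S : Matrix (Fin n) (Fin n) ℚ) :
    EvInt B S ↔ ∀ x : Fin n → ℤ, S *ᵥ vecToRat x ∈ solGroup B hB := by
  constructor
  · rintro ⟨l, Y, hY⟩ x
    refine (mem_solGroup_iff hB).mpr ⟨l, Y *ᵥ x, ?_⟩
    rw [Matrix.mulVec_mulVec, hY, toRat_mulVec]
  · intro h
    refine (evInt_iff hB S).mpr fun j => ?_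
    convert h (Pi.single j 1) using 1
    have : vecToRat (Pi.single j 1 : Fin n → ℤ) = Pi.single j 1 := by
      ext i
      by_cases h : i = j
      · subst h
        simp [vecToRat]
      · simp [vecToRat, h]
    rw [this, Matrix.mulVec_single_one]
    rfl

theorem isHom_iff_mapsTo (hA : A.det ≠ 0) (hB : B.det ≠ 0) (T : Matrix (Fin n) (Fin n) ℚ) :
    IsHom A B hA hB T ↔ ∀ x ∈ solGroup A hA, T *ᵥ x ∈ solGroup B hB := by
  constructor
  · rintro ⟨φ, hφ⟩ x hx
    rw [← hφ ⟨x, hx⟩]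
    exact (φ ⟨x, hx⟩).2
  · intro h
    refine ⟨⟨⟨fun x => ⟨T *ᵥ (x : Fin n → ℚ), h _ x.2⟩, ?_⟩, ?_⟩, fun x => rfl⟩
    · exact Subtype.ext (Matrix.mulVec_zero T)
    · exact fun x y => Subtype.ext (Matrix.mulVec_add T _ _)

/-- `G_A` is the union of the lattices `A⁻¹ ^ k ℤⁿ`, and `T` sends the `k`-th one into `G_B` iff the
columns of `T * A⁻¹ ^ k` lie there. -/
theorem isHom_iff (hA : A.det ≠ 0) (hB : B.det ≠ 0) (T : Matrix (Fin n) (Fin n) ℚ) :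
    IsHom A B hA hB T ↔ ∀ k : ℕ, EvInt B (T * (toRat A)⁻¹ ^ k) := by
  simp only [isHom_iff_mapsTo, evInt_iff_mulVec hB]
  constructor
  · intro h k x
    rw [← Matrix.mulVec_mulVec]
    refine h _ ((mem_solGroup_iff hA).mpr ⟨k, x, ?_⟩)
    rw [Matrix.mulVec_mulVec, pow_mul_inv_pow hA, Matrix.one_mulVec]
  · intro h y hy
    obtain ⟨l, x, hx⟩ := (mem_solGroup_iff hA).mp hy
    have := h l x
    rwa [← hx, Matrix.mulVec_mulVec, mul_assoc, inv_pow_mul_pow hA, mul_one] at this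

theorem isIso_iff (hA : A.det ≠ 0) (hB : B.det ≠ 0) (T : Matrix (Fin n) (Fin n) ℚ) :
    IsIso A B hA hB T ↔ ∃ S, T * S = 1 ∧ IsHom A B hA hB T ∧ IsHom B A hB hA S := by
  constructor
  · rintro ⟨φ, hφ⟩
    obtain ⟨S, hS, -⟩ := existsUnique_matrix hB hA φ.symm.toAddMonoidHom
    refine ⟨S, ?_, ⟨φ.toAddMonoidHom, hφ⟩, ⟨φ.symm.toAddMonoidHom, hS⟩⟩
    -- Both `T * S` and 1 induce the identity of `G_B`, so they agree by uniqueness of the inducing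
    -- matrix.
    obtain ⟨R, -, hR⟩ := existsUnique_matrix hB hB (AddMonoidHom.id _)
    rw [hR (T * S) fun x => ?_, hR 1 fun x => ?_]
    · simp
    · rw [← Matrix.mulVec_mulVec, ← hS x, ← hφ]
      simp
  · rintro ⟨S, hTS, hT, hS⟩
    rw [isHom_iff_mapsTo] at hT hS
    refine ⟨⟨⟨fun x => ⟨T *ᵥ (x : Fin n → ℚ), hT _ x.2⟩, fun x => ⟨S *ᵥ (x : Fin n → ℚ), hS _ x.2⟩,
      fun x => Subtype.ext ?_, fun x => Subtype.ext ?_⟩, fun x y => Subtype.ext ?_⟩,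
      fun x => rfl⟩
    · simp [mul_eq_one_comm.mp hTS]
    · simp [hTS]
    · exact Matrix.mulVec_add T _ _

end Hom

/-! ### A bound for eventual integrality -/

/-- Pigeonhole: the orbit cannot run longer than the size of `X` before first hitting `z`, and once
there it stays. -/
theorem iterate_card_eq_of_iterate_eq {X : Type*} [Fintype X] {f : X → X} {z x : X}
    (hz : f z = z) {l : ℕ} (hl : f^[l] x = z) : f^[Fintype.card X] x = z := by
  classical
  have hex : ∃ l, f^[l] x = z := ⟨l, hl⟩
  have hfix : ∀ k, f^[k] z = z := fun k => Function.iterate_fixed hz k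
  obtain ⟨i, j, hij, he⟩ : ∃ i j : Fin (Fintype.card X + 1), i < j ∧ f^[i] x = f^[j] x := by
    obtain ⟨i, j, hne, he⟩ := Fintype.exists_ne_map_eq_of_card_lt
      (fun i : Fin (Fintype.card X + 1) => f^[i] x) (by simp)
    rcases lt_or_gt_of_ne hne with h | h
    · exact ⟨i, j, h, he⟩
    · exact ⟨j, i, h, he.symm⟩
  have hle : Nat.find hex ≤ Fintype.card X := by
    by_contra hlt
    have hj : (j : ℕ) ≤ Nat.find hex := by omega
    have hij' : (i : ℕ) < j := hij
    -- Cutting out the loop between times `i` and `j` would reach `z` earlier than the first hitting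
    -- time.
    refine Nat.find_min hex (m := Nat.find hex - j + i) (by omega) ?_
    rw [Function.iterate_add_apply, he, ← Function.iterate_add_apply, Nat.sub_add_cancel hj]
    exact Nat.find_spec hex
  obtain ⟨e, he⟩ := Nat.exists_eq_add_of_le hle
  rw [he, add_comm, Function.iterate_add_apply, Nat.find_spec hex, hfix]

theorem map_intCast_eq_zero_iff {n M : ℕ} (S : Matrix (Fin n) (Fin n) ℤ) :
    (Int.castRingHom (ZMod M)).mapMatrix S = 0 ↔
      ∃ Y : Matrix (Fin n) (Fin n) ℤ, S = (M : ℤ) • Y := by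
  have h : ∀ i j, (Int.castRingHom (ZMod M)).mapMatrix S i j = 0 ↔ (M : ℤ) ∣ S i j :=
    fun i j => ZMod.intCast_zmod_eq_zero_iff_dvd (S i j) M
  constructor
  · intro hS
    have h' : ∀ i j, (M : ℤ) ∣ S i j := fun i j => (h i j).mp (by rw [hS]; rfl)
    choose Y hY using h'
    exact ⟨Y, Matrix.ext hY⟩
  · rintro ⟨Y, rfl⟩
    ext i j
    exact (h i j).mpr ⟨Y i j, rfl⟩

/-- Integrality of `B ^ l * S / M` means `B ^ l * S = 0` modulo `M`. The exponent `M ^ (n * n)` is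
the number of `n × n` matrices over `ZMod M`, which bounds the time to reach the fixed point 0. -/
theorem evInt_inv_smul_iff {n M : ℕ} (hM : M ≠ 0) (B S : Matrix (Fin n) (Fin n) ℤ) :
    EvInt B ((M : ℚ)⁻¹ • toRat S) ↔
      ∃ Y : Matrix (Fin n) (Fin n) ℤ, B ^ M ^ (n * n) * S = (M : ℤ) • Y := by
  have hM' : (M : ℚ) ≠ 0 := Nat.cast_ne_zero.mpr hM
  have key : ∀ l, (∃ Y : Matrix (Fin n) (Fin n) ℤ,
      toRat B ^ l * ((M : ℚ)⁻¹ • toRat S) = toRat Y) ↔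
      ∃ Y : Matrix (Fin n) (Fin n) ℤ, B ^ l * S = (M : ℤ) • Y := fun l => by
    refine exists_congr fun Y => ?_
    rw [mul_smul_comm, inv_smul_eq_iff₀ hM', ← toRat_pow, ← toRat_mul,
      ← toRat_injective.eq_iff (a := B ^ l * S), toRat_zsmul, ← Int.cast_smul_eq_zsmul ℚ,
      Int.cast_natCast]
  constructor
  · rintro ⟨l, hl⟩
    have hl := (key l).mp hl
    have := NeZero.mk hM
    have hit : ∀ k, (fun X => (Int.castRingHom (ZMod M)).mapMatrix B * X)^[k]
        ((Int.castRingHom (ZMod M)).mapMatrix S) =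
        (Int.castRingHom (ZMod M)).mapMatrix (B ^ k * S) := fun k => by
      induction k with
      | zero => simp
      | succ k ih => rw [Function.iterate_succ_apply', ih, pow_succ', mul_assoc, map_mul _ B]
    rw [← map_intCast_eq_zero_iff, ← hit] at hl ⊢
    have := iterate_card_eq_of_iterate_eq (mul_zero _) hl
    rwa [show Fintype.card (Matrix (Fin n) (Fin n) (ZMod M)) = M ^ (n * n) by
      change Fintype.card (Fin n → Fin n → ZMod M) = _
      simp [ZMod.card, pow_mul]] at this
  · intro h
    exact ⟨_, (key _).mpr h⟩

/-! ### The algorithms -/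

/-- The sum of matrices given as lists of rows. -/
def ladd (n : ℕ) (L M : List (List ℤ)) : List (List ℤ) :=
  tab n fun i j => entry L i j + entry M i j

theorem toMat_ladd (n : ℕ) (L M : List (List ℤ)) :
    toMat n (ladd n L M) = toMat n L + toMat n M := by
  rw [ladd, toMat_tab]
  rfl

/-- The sum `∑ t < length c, c t • F t`, for matrices given as lists of rows. -/
def lcomb (n : ℕ) (c : List ℤ) (F : ℕ → List (List ℤ)) : List (List ℤ) :=
  tab n fun i j => ∑ t ∈ Finset.range c.length, c.getD t 0 * entry (F t) i j

theorem toMat_lcomb (n : ℕ) (c : List ℤ) (F : ℕ → List (List ℤ)) :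
    toMat n (lcomb n c F) = ∑ t ∈ Finset.range c.length, c.getD t 0 • toMat n (F t) := by
  rw [lcomb, toMat_tab]
  ext i j
  rw [Matrix.sum_apply]
  rfl

/-- Whether `L = M` as `n × n` matrices. -/
def eqTest (n : ℕ) (L M : List (List ℤ)) : Bool := dvdTest n 0 (ladd n L (lsmul n (-1) M))

theorem eqTest_iff (n : ℕ) (L M : List (List ℤ)) :
    eqTest n L M = true ↔ toMat n L = toMat n M := by
  rw [eqTest, dvdTest_zero_iff, toMat_ladd, toMat_lsmul, neg_one_smul, ← sub_eq_add_neg,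
    sub_eq_zero]

section Primrec

variable {α : Type*} [Primcodable α]

theorem primrec_ladd {n : α → ℕ} {L M : α → List (List ℤ)} (hn : Primrec n) (hL : Primrec L)
    (hM : Primrec M) : Primrec fun a => ladd (n a) (L a) (M a) := by
  refine primrec_tab (f := fun a i j => entry (L a) i j + entry (M a) i j) hn
    (primrec_int_add.comp ?_ ?_)
  · exact primrec_entry (hL.comp (Primrec.fst.comp Primrec.fst))
      (Primrec.snd.comp Primrec.fst) Primrec.snd
  · exact primrec_entry (hM.comp (Primrec.fst.comp Primrec.fst))
      (Primrec.snd.comp Primrec.fst) Primrec.snd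

theorem primrec_lcomb {n : α → ℕ} {c : α → List ℤ} {F : α → ℕ → List (List ℤ)}
    (hn : Primrec n) (hc : Primrec c) (hF : Primrec₂ F) :
    Primrec fun a => lcomb (n a) (c a) (F a) := by
  refine primrec_tab hn (primrec_sum (g := fun (p : (α × ℕ) × ℕ) t =>
    (c p.1.1).getD t 0 * entry (F p.1.1 t) p.1.2 p.2)
    (Primrec.list_length.comp (hc.comp (Primrec.fst.comp Primrec.fst)))
    (primrec_int_mul.comp ?_ ?_))
  · exact (Primrec.list_getD 0).comp
      (hc.comp (Primrec.fst.comp (Primrec.fst.comp Primrec.fst))) Primrec.snd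
  · exact primrec_entry
      (hF.comp (Primrec.fst.comp (Primrec.fst.comp Primrec.fst)) Primrec.snd)
      (Primrec.snd.comp (Primrec.fst.comp Primrec.fst)) (Primrec.snd.comp Primrec.fst)

theorem primrec_eqTest {n : α → ℕ} {L M : α → List (List ℤ)} (hn : Primrec n) (hL : Primrec L)
    (hM : Primrec M) : Primrec fun a => eqTest (n a) (L a) (M a) :=
  primrec_dvdTest hn (Primrec.const 0)
    (primrec_ladd hn hL (primrec_lsmul hn (Primrec.const (-1)) hM))

end Primrec

/-- A computable inverse: a matrix `C` and an integer `N` with `A * C = N`, and `N = 0` only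
for singular `A`. -/
theorem exists_computable_inv :
    ∃ f : ℕ × List (List ℤ) → List (List ℤ) × ℕ, Computable f ∧ ∀ a,
      toMat a.1 a.2 * toMat a.1 (f a).1 = ((f a).2 : ℤ) • 1 ∧
        ((f a).2 ≠ 0 ↔ (toMat a.1 a.2).det ≠ 0) := by
  -- A candidate `(C, N)` passes if `A * C = N` and, in case `N = 0`, moreover `C ≠ 0`; the latter
  -- case is a witness of singularity, which makes the search total.
  let p : ℕ × List (List ℤ) → List (List ℤ) × ℕ → Bool := fun a c =>
    eqTest a.1 (lmul a.1 a.2 c.1) (lsmul a.1 c.2 (lpow a.1 a.2 0)) &&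
      (!decide (c.2 = 0) || !dvdTest a.1 0 c.1)
  have hp : Primrec₂ p := by
    have hn : Primrec fun x : (ℕ × List (List ℤ)) × (List (List ℤ) × ℕ) => x.1.1 :=
      Primrec.fst.comp Primrec.fst
    have hA : Primrec fun x : (ℕ × List (List ℤ)) × (List (List ℤ) × ℕ) => x.1.2 :=
      Primrec.snd.comp Primrec.fst
    have hC : Primrec fun x : (ℕ × List (List ℤ)) × (List (List ℤ) × ℕ) => x.2.1 :=
      Primrec.fst.comp Primrec.snd
    have hN : Primrec fun x : (ℕ × List (List ℤ)) × (List (List ℤ) × ℕ) => x.2.2 :=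
      Primrec.snd.comp Primrec.snd
    exact Primrec.and.comp
      (primrec_eqTest hn (primrec_lmul hn hA hC)
        (primrec_lsmul hn (primrec_int_ofNat.comp hN) (primrec_lpow hn hA (Primrec.const 0))))
      (Primrec.or.comp
        (Primrec.not.comp (PrimrecRel.comp Primrec.eq hN (Primrec.const 0)).decide)
        (Primrec.not.comp (primrec_dvdTest hn (Primrec.const 0) hC)))
  have hiff : ∀ a c, p a c = true ↔ toMat a.1 a.2 * toMat a.1 c.1 = (c.2 : ℤ) • 1 ∧
      (c.2 ≠ 0 ∨ toMat a.1 c.1 ≠ 0) := fun a c => by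
    simp only [p, Bool.and_eq_true, Bool.or_eq_true, eqTest_iff, toMat_lmul, toMat_lsmul,
      toMat_lpow, pow_zero, Bool.not_eq_true', decide_eq_false_iff_not,
      ← dvdTest_zero_iff, ne_eq, Bool.not_eq_true]
  obtain ⟨f, hf, hpf⟩ := exists_computable_search p hp.to_comp fun a => by
    have htab : ∀ X : Matrix (Fin a.1) (Fin a.1) ℤ, ∃ L, toMat a.1 L = X :=
      fun X => ⟨_, toMat_intMatCode X⟩
    by_cases hA : (toMat a.1 a.2).det = 0
    · obtain ⟨v, hv, hAv⟩ := Matrix.exists_mulVec_eq_zero_iff.mpr hA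
      obtain ⟨i, hi⟩ := Function.ne_iff.mp hv
      -- A kernel vector of `A`, repeated in every column.
      obtain ⟨L, hL⟩ := htab (Matrix.of fun i _ => v i)
      refine ⟨(L, 0), (hiff _ _).mpr ⟨?_, Or.inr ?_⟩⟩
      · rw [hL]
        ext i j
        simpa [Matrix.mul_apply, Matrix.mulVec, dotProduct] using congrFun hAv i
      · rw [hL]
        exact fun h => hi (congrFun (congrFun h i) i)
    -- The sign turns the scalar `det A` of the adjugate identity into the natural number `|det A|`.
    · obtain ⟨L, hL⟩ := htab ((toMat a.1 a.2).det.sign • (toMat a.1 a.2).adjugate)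
      refine ⟨(L, (toMat a.1 a.2).det.natAbs), (hiff _ _).mpr ⟨?_, Or.inl ?_⟩⟩
      · rw [hL, mul_smul_comm, Matrix.mul_adjugate, smul_smul, Int.sign_mul_self_eq_natAbs]
      · exact Int.natAbs_ne_zero.mpr hA
  refine ⟨f, hf, fun a => ?_⟩
  obtain ⟨h1, h2⟩ := (hiff _ _).mp (hpf a)
  refine ⟨h1, fun hN hdet => ?_, fun hdet hN => ?_⟩
  · have := congrArg Matrix.det h1
    rw [Matrix.det_mul, hdet, zero_mul, Matrix.det_smul, Matrix.det_one, mul_one] at this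
    exact pow_ne_zero _ (Int.natCast_ne_zero.mpr hN) this.symm
  · rw [hN, Nat.cast_zero, zero_smul] at h1
    refine (h2.resolve_left (not_not.mpr hN)) ?_
    -- From `A * C = 0` the adjugate gives `det A • C = 0`, hence `C = 0` for non-singular `A`.
    have := congrArg ((toMat a.1 a.2).adjugate * ·) h1
    simp only [← mul_assoc, Matrix.adjugate_mul, smul_mul_assoc, one_mul, mul_zero] at this
    exact (smul_eq_zero.mp this).resolve_left hdet

/-- The test whether the columns of the matrix with rows `X`, divided by `M`, lie in `G_B`. -/
def memTest (n : ℕ) (B X : List (List ℤ)) (M : ℕ) : Bool :=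
  dvdTest n M (lmul n (lpow n B (M ^ (n * n))) X)

theorem memTest_iff {n M : ℕ} (hM : M ≠ 0) (B X : List (List ℤ)) :
    memTest n B X M = true ↔ EvInt (toMat n B) ((M : ℚ)⁻¹ • toRat (toMat n X)) := by
  rw [memTest, dvdTest_iff, evInt_inv_smul_iff hM, toMat_lmul, toMat_lpow]

theorem primrec_memTest {α : Type*} [Primcodable α] {n M : α → ℕ} {B X : α → List (List ℤ)}
    (hn : Primrec n) (hB : Primrec B) (hX : Primrec X) (hM : Primrec M) :
    Primrec fun a => memTest (n a) (B a) (X a) (M a) :=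
  primrec_dvdTest hn hM (primrec_lmul hn
    (primrec_lpow hn hB (primrec_nat_pow.comp hM (Primrec.nat_mul.comp hn hn))) hX)

/-- The test of a certificate that the matrix with rows `X`, divided by `N`, maps `G_A` to
`G_B`. -/
def homCertTest (n : ℕ) (A B X : List (List ℤ)) (N l m : ℕ) (Y : List (List ℤ)) (c : List ℤ) :
    Bool :=
  eqTest n (lmul n (lpow n B l) X) (lmul n (lsmul n N Y) (lpow n A c.length)) &&
    dvdTest n 0 (ladd n (lmul n (lpow n B (m * c.length)) X)
      (lcomb n c fun t => lmul n (lmul n (lpow n B (m * t)) X) (lpow n A (c.length - t))))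

/-- With `T = X / N` and `d` the length of `c`, the first equation says that `B ^ l * T * A⁻¹ ^ d`
is the integral matrix `Y` when `A` is invertible and `N ≠ 0`. The second is the recurrence; being
linear in `X`, it does not involve `N`. -/
theorem homCertTest_iff (n : ℕ) (A B X : List (List ℤ)) (N l m : ℕ) (Y : List (List ℤ))
    (c : List ℤ) : homCertTest n A B X N l m Y c = true ↔
      toMat n B ^ l * toMat n X = (N : ℤ) • toMat n Y * toMat n A ^ c.length ∧
      toMat n B ^ (m * c.length) * toMat n X + ∑ t ∈ Finset.range c.length,
        c.getD t 0 • (toMat n B ^ (m * t) * toMat n X * toMat n A ^ (c.length - t)) = 0 := by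
  simp only [homCertTest, Bool.and_eq_true, eqTest_iff, dvdTest_zero_iff, toMat_ladd,
    toMat_lcomb, toMat_lmul, toMat_lpow, toMat_lsmul]

theorem primrec_homCertTest {α : Type*} [Primcodable α] {n N l m : α → ℕ}
    {A B X Y : α → List (List ℤ)} {c : α → List ℤ} (hn : Primrec n) (hA : Primrec A)
    (hB : Primrec B) (hX : Primrec X) (hN : Primrec N) (hl : Primrec l) (hm : Primrec m)
    (hY : Primrec Y) (hc : Primrec c) :
    Primrec fun a => homCertTest (n a) (A a) (B a) (X a) (N a) (l a) (m a) (Y a) (c a) := by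
  have hd : Primrec fun a => (c a).length := Primrec.list_length.comp hc
  refine Primrec.and.comp
    (primrec_eqTest hn (primrec_lmul hn (primrec_lpow hn hB hl) hX)
      (primrec_lmul hn (primrec_lsmul hn (primrec_int_ofNat.comp hN) hY)
        (primrec_lpow hn hA hd)))
    (primrec_dvdTest hn (Primrec.const 0) (primrec_ladd hn
      (primrec_lmul hn (primrec_lpow hn hB (Primrec.nat_mul.comp hm hd)) hX)
      (primrec_lcomb (F := fun a t => lmul (n a) (lmul (n a) (lpow (n a) (B a) (m a * t)) (X a))
        (lpow (n a) (A a) ((c a).length - t))) hn hc ?_)))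
  have hn' := hn.comp (Primrec.fst (α := α) (β := ℕ))
  exact primrec_lmul hn'
    (primrec_lmul hn' (primrec_lpow hn' (hB.comp Primrec.fst)
      (Primrec.nat_mul.comp (hm.comp Primrec.fst) Primrec.snd)) (hX.comp Primrec.fst))
    (primrec_lpow hn' (hA.comp Primrec.fst)
      (Primrec.nat_sub.comp (hd.comp Primrec.fst) Primrec.snd))

theorem exists_homCertTest_iff {n N : ℕ} (hN : N ≠ 0) {A : List (List ℤ)}
    (hA : (toMat n A).det ≠ 0) (B X : List (List ℤ)) :
    (∃ l m Y c, homCertTest n A B X N l m Y c = true) ↔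
      ∀ k : ℕ, EvInt (toMat n B)
        ((N : ℚ)⁻¹ • toRat (toMat n X) * (toRat (toMat n A))⁻¹ ^ k) := by
  have hN' : (N : ℚ) ≠ 0 := Nat.cast_ne_zero.mpr hN
  simp only [homCertTest_iff]
  constructor
  · rintro ⟨l, m, Y, c, h1, h2⟩
    refine evInt_of_certificate hA (m := m) (d := c.length) (fun t => c.getD t 0) ⟨l, toMat n Y, ?_⟩ ?_
    · have h := congrArg toRat h1
      rw [toRat_mul, toRat_mul, toRat_pow, toRat_pow, toRat_zsmul, ← Int.cast_smul_eq_zsmul ℚ,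
        Int.cast_natCast] at h
      rw [← mul_assoc, mul_smul_comm, h, smul_mul_assoc, smul_mul_assoc, smul_mul_assoc,
        inv_smul_smul₀ hN', mul_assoc, pow_mul_inv_pow hA, mul_one]
    · have h := congrArg (fun Z => (N : ℚ)⁻¹ • toRat Z) h2
      simp only [toRat_add, toRat_sum, toRat_zsmul, toRat_mul, toRat_pow, toRat_zero, smul_zero,
        smul_add, Finset.smul_sum] at h
      rw [← h, mul_smul_comm]
      congr 1
      refine Finset.sum_congr rfl fun t _ => ?_
      rw [mul_smul_comm, smul_mul_assoc, smul_comm]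
  · intro h
    -- The recurrence is obtained for the integral multiple `X = N • T`, which again induces a
    -- homomorphism.
    obtain ⟨m, d, c, hc⟩ := exists_certificate hA (toMat n X) fun k => by
      have := (h k).zsmul N
      rwa [smul_mul_assoc, ← Int.cast_smul_eq_zsmul ℚ, Int.cast_natCast,
        smul_inv_smul₀ hN'] at this
    obtain ⟨l, Y, hY⟩ := h d
    refine ⟨l, m, intMatCode Y, (List.range d).map c, ?_, ?_⟩
    · apply toRat_injective
      rw [List.length_map, List.length_range, toMat_intMatCode, toRat_mul, toRat_mul, toRat_pow,
        toRat_pow, toRat_zsmul, ← hY, ← Int.cast_smul_eq_zsmul ℚ, Int.cast_natCast,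
        smul_mul_assoc, smul_mul_assoc, mul_smul_comm, smul_mul_assoc, smul_inv_smul₀ hN',
        mul_assoc, mul_assoc, inv_pow_mul_pow hA, mul_one]
    · rw [List.length_map, List.length_range, ← hc]
      congr 1
      refine Finset.sum_congr rfl fun t ht => ?_
      simp [List.getD_eq_getElem?_getD, Finset.mem_range.mp ht]

/-- The homomorphism problem, for matrices with a common denominator. -/
theorem exists_computable_hom :
    ∃ f : ℕ × List (List ℤ) × List (List ℤ) × List (List ℤ) × ℕ → Bool, Computable f ∧
      ∀ (n : ℕ) (A B X : List (List ℤ)) (N : ℕ), N ≠ 0 → (toMat n A).det ≠ 0 →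
        (f (n, A, B, X, N) = true ↔ ∀ k : ℕ, EvInt (toMat n B)
          ((N : ℚ)⁻¹ • toRat (toMat n X) * (toRat (toMat n A))⁻¹ ^ k)) := by
  obtain ⟨inv, hinv, hinv'⟩ := exists_computable_inv
  -- The Boolean tags the kind of witness: `true` for a certificate, `false` for an exponent `k`,
  -- kept in the slot of `l`, at which `T * A⁻¹ ^ k` fails the membership test. The pair `a.2 = (C,
  -- M)` represents `A⁻¹ = C / M`.
  let p : (ℕ × List (List ℤ) × List (List ℤ) × List (List ℤ) × ℕ) × (List (List ℤ) × ℕ) →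
      Bool × ℕ × ℕ × List (List ℤ) × List ℤ → Bool := fun a c =>
    cond c.1 (homCertTest a.1.1 a.1.2.1 a.1.2.2.1 a.1.2.2.2.1 a.1.2.2.2.2 c.2.1 c.2.2.1 c.2.2.2.1
        c.2.2.2.2)
      (!memTest a.1.1 a.1.2.2.1 (lmul a.1.1 a.1.2.2.2.1 (lpow a.1.1 a.2.1 c.2.1))
        (a.1.2.2.2.2 * a.2.2 ^ c.2.1))
  -- Zero denominators and singular `A` accept every candidate, so that the search terminates on all
  -- inputs.
  let q := fun a c => (decide (a.1.2.2.2.2 = 0) || decide (a.2.2 = 0)) || p a c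
  have hq : Primrec₂ q := by
    let α := ((ℕ × List (List ℤ) × List (List ℤ) × List (List ℤ) × ℕ) ×
      (List (List ℤ) × ℕ)) × (Bool × ℕ × ℕ × List (List ℤ) × List ℤ)
    have h0 : Primrec fun x : α => x.1.1 := Primrec.fst.comp Primrec.fst
    have hn : Primrec fun x : α => x.1.1.1 := Primrec.fst.comp h0
    have h1 : Primrec fun x : α => x.1.1.2 := Primrec.snd.comp h0
    have hA : Primrec fun x : α => x.1.1.2.1 := Primrec.fst.comp h1
    have h2 : Primrec fun x : α => x.1.1.2.2 := Primrec.snd.comp h1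
    have hB : Primrec fun x : α => x.1.1.2.2.1 := Primrec.fst.comp h2
    have h3 : Primrec fun x : α => x.1.1.2.2.2 := Primrec.snd.comp h2
    have hX : Primrec fun x : α => x.1.1.2.2.2.1 := Primrec.fst.comp h3
    have hN : Primrec fun x : α => x.1.1.2.2.2.2 := Primrec.snd.comp h3
    have h4 : Primrec fun x : α => x.1.2 := Primrec.snd.comp Primrec.fst
    have hC : Primrec fun x : α => x.1.2.1 := Primrec.fst.comp h4
    have hM : Primrec fun x : α => x.1.2.2 := Primrec.snd.comp h4
    have hb : Primrec fun x : α => x.2.1 := Primrec.fst.comp Primrec.snd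
    have h5 : Primrec fun x : α => x.2.2 := Primrec.snd.comp Primrec.snd
    have hl : Primrec fun x : α => x.2.2.1 := Primrec.fst.comp h5
    have h6 : Primrec fun x : α => x.2.2.2 := Primrec.snd.comp h5
    have hm : Primrec fun x : α => x.2.2.2.1 := Primrec.fst.comp h6
    have h7 : Primrec fun x : α => x.2.2.2.2 := Primrec.snd.comp h6
    have hY : Primrec fun x : α => x.2.2.2.2.1 := Primrec.fst.comp h7
    have hc : Primrec fun x : α => x.2.2.2.2.2 := Primrec.snd.comp h7
    exact Primrec.or.comp
      (Primrec.or.comp (PrimrecRel.comp Primrec.eq hN (Primrec.const 0)).decide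
        (PrimrecRel.comp Primrec.eq hM (Primrec.const 0)).decide)
      (Primrec.cond hb (primrec_homCertTest hn hA hB hX hN hl hm hY hc)
        (Primrec.not.comp (primrec_memTest hn hB (primrec_lmul hn hX (primrec_lpow hn hC hl))
          (Primrec.nat_mul.comp hN (primrec_nat_pow.comp hM hl)))))
  have hmem : ∀ (n : ℕ) (A B X : List (List ℤ)) (N k : ℕ), N ≠ 0 → (toMat n A).det ≠ 0 →
      (memTest n B (lmul n X (lpow n (inv (n, A)).1 k)) (N * (inv (n, A)).2 ^ k) = true ↔
        EvInt (toMat n B) ((N : ℚ)⁻¹ • toRat (toMat n X) * (toRat (toMat n A))⁻¹ ^ k)) := by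
    intro n A B X N k hN hA
    obtain ⟨h1, h2⟩ := hinv' (n, A)
    have hM := h2.mpr hA
    have hM' : ((inv (n, A)).2 : ℚ) ≠ 0 := Nat.cast_ne_zero.mpr hM
    have hC : (toRat (toMat n A))⁻¹ =
        ((inv (n, A)).2 : ℚ)⁻¹ • toRat (toMat n (inv (n, A)).1) := by
      refine Matrix.inv_eq_right_inv ?_
      rw [mul_smul_comm, ← toRat_mul, h1, toRat_zsmul, toRat_one, ← Int.cast_smul_eq_zsmul ℚ,
        Int.cast_natCast, inv_smul_smul₀ hM']
    rw [memTest_iff (mul_ne_zero hN (pow_ne_zero k hM)), toMat_lmul, toMat_lpow, toRat_mul,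
      toRat_pow, hC, smul_pow, smul_mul_smul_comm, Nat.cast_mul, Nat.cast_pow, mul_inv, inv_pow]
  obtain ⟨g, hg, hqg⟩ := exists_computable_search
    (fun a => q (a, inv (a.1, a.2.1)))
    (hq.to_comp.comp (Computable.pair Computable.fst (hinv.comp (Computable.pair
      (Computable.fst.comp Computable.fst)
      (Computable.fst.comp (Computable.snd.comp Computable.fst))))) Computable.snd) (by
    rintro ⟨n, A, B, X, N⟩
    by_cases hN : N = 0
    · exact ⟨(true, 0, 0, [], []), by simp [q, hN]⟩
    by_cases hM : (inv (n, A)).2 = 0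
    · exact ⟨(true, 0, 0, [], []), by simp [q, hM]⟩
    have hA := (hinv' (n, A)).2.mp hM
    -- Either every `k` passes and a certificate exists, or some `k` is a counterexample.
    by_cases h : ∀ k : ℕ, EvInt (toMat n B)
        ((N : ℚ)⁻¹ • toRat (toMat n X) * (toRat (toMat n A))⁻¹ ^ k)
    · obtain ⟨l, m, Y, c, hc⟩ := (exists_homCertTest_iff hN hA B X).mpr h
      exact ⟨(true, l, m, Y, c), by simp [q, p, hc]⟩
    · obtain ⟨k, hk⟩ := not_forall.mp h
      rw [← hmem n A B X N k hN hA] at hk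
      exact ⟨(false, k, 0, [], []), by simp [q, p, hk]⟩)
  -- The answer is the tag of the witness found; both kinds of witness are sound.
  refine ⟨fun a => (g a).1, Computable.fst.comp hg, fun n A B X N hN hA => ?_⟩
  have hM := (hinv' (n, A)).2.mpr hA
  have h := hqg (n, A, B, X, N)
  change (g (n, A, B, X, N)).1 = true ↔ _
  generalize g (n, A, B, X, N) = w at h ⊢
  obtain ⟨b, k, m, Y, c⟩ := w
  cases b with
  | true =>
    refine ⟨fun _ => (exists_homCertTest_iff hN hA B X).mp ⟨k, m, Y, c, ?_⟩, fun _ => rfl⟩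
    simpa [q, p, hN, hM] using h
  | false =>
    refine ⟨fun hf => absurd hf Bool.false_ne_true, fun hall => absurd h ?_⟩
    have := (hmem n A B X N k hN hA).mpr (hall k)
    simp [q, p, hN, hM, this]

/-- The isomorphism problem, for matrices with a common denominator. -/
theorem exists_computable_iso :
    ∃ f : ℕ × List (List ℤ) × List (List ℤ) × List (List ℤ) × ℕ → Bool, Computable f ∧
      ∀ (n : ℕ) (A B X : List (List ℤ)) (N : ℕ) (hA : (toMat n A).det ≠ 0)
        (hB : (toMat n B).det ≠ 0), N ≠ 0 → (f (n, A, B, X, N) = true ↔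
          IsIso (toMat n A) (toMat n B) hA hB ((N : ℚ)⁻¹ • toRat (toMat n X))) := by
  obtain ⟨inv, hinv, hinv'⟩ := exists_computable_inv
  obtain ⟨hom, hhom, hhom'⟩ := exists_computable_hom
  have hn : Computable fun x : ℕ × List (List ℤ) × List (List ℤ) × List (List ℤ) × ℕ => x.1 :=
    Computable.fst
  have hA : Computable fun x : ℕ × List (List ℤ) × List (List ℤ) × List (List ℤ) × ℕ => x.2.1 :=
    Computable.fst.comp Computable.snd
  have h2 : Computable fun x : ℕ × List (List ℤ) × List (List ℤ) × List (List ℤ) × ℕ => x.2.2 :=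
    Computable.snd.comp Computable.snd
  have hB := Computable.fst.comp h2
  have hX := Computable.fst.comp (Computable.snd.comp h2)
  have hN := Computable.snd.comp (Computable.snd.comp h2)
  have hi := hinv.comp (Computable.pair hn hX)
  have hsmul : Primrec fun x : ℕ × ℕ × List (List ℤ) => lsmul x.1 x.2.1 x.2.2 :=
    primrec_lsmul Primrec.fst
      (primrec_int_ofNat.comp (Primrec.fst.comp Primrec.snd)) (Primrec.snd.comp Primrec.snd)
  -- If `X * C = M` with `M ≠ 0`, the inverse of `X / N` is `(N • C) / M`; `M = 0` means that `X` is
  -- singular, and the answer is no.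
  refine ⟨fun x => !decide ((inv (x.1, x.2.2.2.1)).2 = 0) && (hom x && hom (x.1, x.2.2.1, x.2.1,
    lsmul x.1 x.2.2.2.2 (inv (x.1, x.2.2.2.1)).1, (inv (x.1, x.2.2.2.1)).2)), ?_, ?_⟩
  · refine Primrec.and.to_comp.comp (Primrec.not.to_comp.comp ?_)
      (Primrec.and.to_comp.comp hhom (hhom.comp ?_))
    · exact (PrimrecRel.comp Primrec.eq Primrec.id (Primrec.const 0)).decide.to_comp.comp
        (Computable.snd.comp hi)
    · exact hn.pair (hB.pair (hA.pair
        ((hsmul.to_comp.comp (hn.pair (hN.pair (Computable.fst.comp hi)))).pair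
          (Computable.snd.comp hi))))
  · intro n A B X N hA hB hN
    obtain ⟨h1, h2⟩ := hinv' (n, X)
    have hN' : (N : ℚ) ≠ 0 := Nat.cast_ne_zero.mpr hN
    simp only [Bool.and_eq_true, Bool.not_eq_true', decide_eq_false_iff_not]
    rw [isIso_iff]
    by_cases hM : (inv (n, X)).2 = 0
    · refine iff_of_false (fun h => h.1 hM) ?_
      rintro ⟨S, hS, -⟩
      have hdet : (toMat n X).det = 0 := not_not.mp fun h => h2.mpr h hM
      have hdet' : (toRat (toMat n X)).det = 0 := by
        rw [toRat_eq, ← RingHom.map_det, hdet, map_zero]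
      have := congrArg Matrix.det hS
      rw [Matrix.det_mul, Matrix.det_smul, hdet', mul_zero, zero_mul, Matrix.det_one] at this
      exact zero_ne_one this
    · have hM' : ((inv (n, X)).2 : ℚ) ≠ 0 := Nat.cast_ne_zero.mpr hM
      have hinvT : (N : ℚ)⁻¹ • toRat (toMat n X) *
          (((inv (n, X)).2 : ℚ)⁻¹ • toRat (toMat n (lsmul n N (inv (n, X)).1))) = 1 := by
        rw [toMat_lsmul, toRat_zsmul, ← Int.cast_smul_eq_zsmul ℚ, Int.cast_natCast,
          smul_mul_smul_comm, mul_smul_comm, ← toRat_mul, h1, toRat_zsmul, toRat_one,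
          ← Int.cast_smul_eq_zsmul ℚ, Int.cast_natCast, smul_smul, smul_smul]
        field_simp
        rw [one_smul]
      rw [hhom' n A B X N hN hA, hhom' n B A _ _ hM hB, ← isHom_iff hA hB, ← isHom_iff hB hA]
      refine ⟨fun h => ⟨_, hinvT, h.2⟩, ?_⟩
      rintro ⟨S, hS, hT, hS'⟩
      refine ⟨hM, hT, ?_⟩
      rwa [left_inv_eq_right_inv (mul_eq_one_comm.mp hinvT) hS]

/-! ### Input data -/

/-- The entry of a list of rows of fractions, zero outside its range. -/
def ratEntry (L : List (List (ℤ × ℕ))) (i j : ℕ) : ℤ × ℕ := (L.getD i []).getD j (0, 1)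

/-- The product of the denominators of a matrix of fractions. -/
def commonDen (n : ℕ) (L : List (List (ℤ × ℕ))) : ℕ :=
  ∏ i ∈ Finset.range n, ∏ j ∈ Finset.range n, (ratEntry L i j).2

/-- The numerators of a matrix of fractions over the common denominator. -/
def numerators (n : ℕ) (L : List (List (ℤ × ℕ))) : List (List ℤ) :=
  tab n fun i j => (ratEntry L i j).1 * (commonDen n L / (ratEntry L i j).2 : ℕ)

section Primrec

variable {α : Type*} [Primcodable α]

theorem primrec_ratEntry {L : α → List (List (ℤ × ℕ))} {i j : α → ℕ} (hL : Primrec L)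
    (hi : Primrec i) (hj : Primrec j) : Primrec fun a => ratEntry (L a) (i a) (j a) :=
  (Primrec.list_getD (0, 1)).comp ((Primrec.list_getD []).comp hL hi) hj

theorem primrec_commonDen {n : α → ℕ} {L : α → List (List (ℤ × ℕ))} (hn : Primrec n)
    (hL : Primrec L) : Primrec fun a => commonDen (n a) (L a) := by
  refine primrec_prod (g := fun a i => ∏ j ∈ Finset.range (n a), (ratEntry (L a) i j).2) hn
    (primrec_prod (g := fun (p : α × ℕ) j => (ratEntry (L p.1) p.2 j).2) (hn.comp Primrec.fst)
      (Primrec.snd.comp ?_))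
  exact primrec_ratEntry (hL.comp (Primrec.fst.comp Primrec.fst))
    (Primrec.snd.comp Primrec.fst) Primrec.snd

theorem primrec_numerators {n : α → ℕ} {L : α → List (List (ℤ × ℕ))} (hn : Primrec n)
    (hL : Primrec L) : Primrec fun a => numerators (n a) (L a) := by
  have he : Primrec fun p : (α × ℕ) × ℕ => ratEntry (L p.1.1) p.1.2 p.2 :=
    primrec_ratEntry (hL.comp (Primrec.fst.comp Primrec.fst))
      (Primrec.snd.comp Primrec.fst) Primrec.snd
  exact primrec_tab hn (primrec_int_mul.comp (Primrec.fst.comp he)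
    (primrec_int_ofNat.comp (Primrec.nat_div.comp
      ((primrec_commonDen hn hL).comp (Primrec.fst.comp Primrec.fst)) (Primrec.snd.comp he))))

end Primrec

theorem ratEntry_ratMatCode {n : ℕ} (T : Matrix (Fin n) (Fin n) ℚ) (i j : Fin n) :
    ratEntry (ratMatCode T) i j = ratCode (T i j) := by
  simp [ratEntry, ratMatCode, List.getD_eq_getElem?_getD]

theorem commonDen_ratMatCode {n : ℕ} (T : Matrix (Fin n) (Fin n) ℚ) :
    commonDen n (ratMatCode T) = ∏ i, ∏ j, (T i j).den := by
  rw [commonDen, Finset.prod_range]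
  refine Finset.prod_congr rfl fun i _ => ?_
  rw [Finset.prod_range]
  exact Finset.prod_congr rfl fun j _ => by rw [ratEntry_ratMatCode]; rfl

theorem commonDen_ne_zero {n : ℕ} (T : Matrix (Fin n) (Fin n) ℚ) :
    commonDen n (ratMatCode T) ≠ 0 := by
  rw [commonDen_ratMatCode]
  exact Finset.prod_ne_zero_iff.mpr fun i _ => Finset.prod_ne_zero_iff.mpr fun j _ =>
    (T i j).den_nz

theorem commonDen_inv_smul_numerators {n : ℕ} (T : Matrix (Fin n) (Fin n) ℚ) :
    (commonDen n (ratMatCode T) : ℚ)⁻¹ • toRat (toMat n (numerators n (ratMatCode T))) = T := by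
  have hD : (commonDen n (ratMatCode T) : ℚ) ≠ 0 := Nat.cast_ne_zero.mpr (commonDen_ne_zero T)
  rw [inv_smul_eq_iff₀ hD]
  ext i j
  have hdvd : (T i j).den ∣ commonDen n (ratMatCode T) := by
    rw [commonDen_ratMatCode]
    exact (Finset.dvd_prod_of_mem (fun j => (T i j).den) (Finset.mem_univ j)).trans
      (Finset.dvd_prod_of_mem (fun i => ∏ j, (T i j).den) (Finset.mem_univ i))
  have hd : ((T i j).den : ℚ) ≠ 0 := Nat.cast_ne_zero.mpr (T i j).den_nz
  rw [numerators, toMat_tab]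
  simp only [toRat, Matrix.map_apply, Matrix.of_apply, ratEntry_ratMatCode, ratCode,
    Matrix.smul_apply, smul_eq_mul]
  rw [Int.cast_mul, Int.cast_natCast, Nat.cast_div hdvd hd]
  conv_rhs => rw [← Rat.num_div_den (T i j)]
  field_simp

theorem length_intMatCode {n : ℕ} (A : Matrix (Fin n) (Fin n) ℤ) :
    (intMatCode A).length = n := List.length_ofFn

/-- A vector is tested as the square matrix all of whose columns equal it, so the matrix test also
decides membership of vectors. -/
theorem map_ratVecCode {n : ℕ} (x : Fin n → ℚ) :
    ((ratVecCode x).map fun q => (ratVecCode x).map fun _ => q) =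
      ratMatCode (Matrix.of fun i _ => x i) := by
  simp [ratVecCode, ratMatCode, List.map_ofFn, Function.comp_def]

/-! ### Decision procedures on coded matrices and vectors -/

theorem exists_computable_mem :
    ∃ f : List (List ℤ) × List (ℤ × ℕ) → Bool, Computable f ∧
      ∀ (n : ℕ) (A : Matrix (Fin n) (Fin n) ℤ) (hA : A.det ≠ 0) (x : Fin n → ℚ),
        f (intMatCode A, ratVecCode x) = true ↔ x ∈ solGroup A hA := by
  let cols : List (ℤ × ℕ) → List (List (ℤ × ℕ)) := fun L => L.map fun q => L.map fun _ => q
  have hcols : Primrec cols :=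
    Primrec.list_map Primrec.id
      (Primrec.list_map (f := fun p : List (ℤ × ℕ) × (ℤ × ℕ) => p.1) (g := fun p _ => p.2)
        Primrec.fst (Primrec.snd.comp Primrec.fst))
  -- The dimension is not part of the input; it is read off as the number of rows of `A`.
  have hn : Primrec fun a : List (List ℤ) × List (ℤ × ℕ) => a.1.length :=
    Primrec.list_length.comp Primrec.fst
  have hc : Primrec fun a : List (List ℤ) × List (ℤ × ℕ) => cols a.2 := hcols.comp Primrec.snd
  refine ⟨fun a => memTest a.1.length a.1 (numerators a.1.length (cols a.2))
    (commonDen a.1.length (cols a.2)), ?_, fun n A hA x => ?_⟩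
  · exact (primrec_memTest hn Primrec.fst (primrec_numerators hn hc)
      (primrec_commonDen hn hc)).to_comp
  · have hx : cols (ratVecCode x) = ratMatCode (Matrix.of fun i _ => x i) := map_ratVecCode x
    simp only [length_intMatCode, hx]
    rw [memTest_iff (commonDen_ne_zero _), commonDen_inv_smul_numerators, toMat_intMatCode,
      evInt_iff hA]
    refine ⟨fun h => ?_, fun h _ => h⟩
    -- For `n = 0` there is no column to test, but the only vector is 0.
    cases n with
    | zero =>
      rw [Subsingleton.elim x 0]
      exact zero_mem _
    | succ n => exact h 0

theorem exists_computable_isHom :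
    ∃ f : List (List ℤ) × List (List ℤ) × List (List (ℤ × ℕ)) → Bool, Computable f ∧
      ∀ (n : ℕ) (A B : Matrix (Fin n) (Fin n) ℤ) (hA : A.det ≠ 0) (hB : B.det ≠ 0)
        (T : Matrix (Fin n) (Fin n) ℚ),
        f (intMatCode A, intMatCode B, ratMatCode T) = true ↔ IsHom A B hA hB T := by
  obtain ⟨f, hf, hf'⟩ := exists_computable_hom
  have hn : Primrec fun a : List (List ℤ) × List (List ℤ) × List (List (ℤ × ℕ)) =>
    a.1.length := Primrec.list_length.comp Primrec.fst
  have hT : Primrec fun a : List (List ℤ) × List (List ℤ) × List (List (ℤ × ℕ)) => a.2.2 :=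
    Primrec.snd.comp Primrec.snd
  refine ⟨fun a => f (a.1.length, a.1, a.2.1, numerators a.1.length a.2.2,
    commonDen a.1.length a.2.2), hf.comp ?_, fun n A B hA hB T => ?_⟩
  · exact (hn.pair (Primrec.fst.pair ((Primrec.fst.comp Primrec.snd).pair
      ((primrec_numerators hn hT).pair (primrec_commonDen hn hT))))).to_comp
  · simp only [length_intMatCode]
    rw [hf' n _ _ _ _ (commonDen_ne_zero T) (by rwa [toMat_intMatCode]),
      commonDen_inv_smul_numerators, isHom_iff, toMat_intMatCode, toMat_intMatCode]

theorem exists_computable_isIso :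
    ∃ f : List (List ℤ) × List (List ℤ) × List (List (ℤ × ℕ)) → Bool, Computable f ∧
      ∀ (n : ℕ) (A B : Matrix (Fin n) (Fin n) ℤ) (hA : A.det ≠ 0) (hB : B.det ≠ 0)
        (T : Matrix (Fin n) (Fin n) ℚ),
        f (intMatCode A, intMatCode B, ratMatCode T) = true ↔ IsIso A B hA hB T := by
  obtain ⟨f, hf, hf'⟩ := exists_computable_iso
  have hn : Primrec fun a : List (List ℤ) × List (List ℤ) × List (List (ℤ × ℕ)) =>
    a.1.length := Primrec.list_length.comp Primrec.fst
  have hT : Primrec fun a : List (List ℤ) × List (List ℤ) × List (List (ℤ × ℕ)) => a.2.2 :=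
    Primrec.snd.comp Primrec.snd
  refine ⟨fun a => f (a.1.length, a.1, a.2.1, numerators a.1.length a.2.2,
    commonDen a.1.length a.2.2), hf.comp ?_, fun n A B hA hB T => ?_⟩
  · exact (hn.pair (Primrec.fst.pair ((Primrec.fst.comp Primrec.snd).pair
      ((primrec_numerators hn hT).pair (primrec_commonDen hn hT))))).to_comp
  · simp only [length_intMatCode]
    rw [hf' n _ _ _ _ (by rwa [toMat_intMatCode]) (by rwa [toMat_intMatCode])
      (commonDen_ne_zero T), commonDen_inv_smul_numerators]
    simp only [toMat_intMatCode]

end SolenoidGroup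

theorem mainTheorem6 :
    -- membership of rational vectors in `G_A`
    (∃ f : List (List ℤ) × List (ℤ × ℕ) → Bool, Computable f ∧
      ∀ (n : ℕ) (A : Matrix (Fin n) (Fin n) ℤ) (hA : A.det ≠ 0) (x : Fin n → ℚ),
        f (SolenoidGroup.intMatCode A, SolenoidGroup.ratVecCode x) = true ↔
          x ∈ SolenoidGroup.solGroup A hA) ∧
    -- membership of rational matrices in `End(G_A)`
    (∃ f : List (List ℤ) × List (List (ℤ × ℕ)) → Bool, Computable f ∧
      ∀ (n : ℕ) (A : Matrix (Fin n) (Fin n) ℤ) (hA : A.det ≠ 0)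
        (T : Matrix (Fin n) (Fin n) ℚ),
        f (SolenoidGroup.intMatCode A, SolenoidGroup.ratMatCode T) = true ↔
          T ∈ SolenoidGroup.endSet A hA) ∧
    -- membership of rational matrices in `Aut(G_A)`
    (∃ f : List (List ℤ) × List (List (ℤ × ℕ)) → Bool, Computable f ∧
      ∀ (n : ℕ) (A : Matrix (Fin n) (Fin n) ℤ) (hA : A.det ≠ 0)
        (T : Matrix (Fin n) (Fin n) ℚ),
        f (SolenoidGroup.intMatCode A, SolenoidGroup.ratMatCode T) = true ↔
          T ∈ SolenoidGroup.autSet A hA) ∧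
    -- whether a rational matrix is a homomorphism from `G_A` to `G_B`
    (∃ f : List (List ℤ) × List (List ℤ) × List (List (ℤ × ℕ)) → Bool, Computable f ∧
      ∀ (n : ℕ) (A B : Matrix (Fin n) (Fin n) ℤ) (hA : A.det ≠ 0) (hB : B.det ≠ 0)
        (T : Matrix (Fin n) (Fin n) ℚ),
        f (SolenoidGroup.intMatCode A, SolenoidGroup.intMatCode B,
            SolenoidGroup.ratMatCode T) = true ↔
          SolenoidGroup.IsHom A B hA hB T) ∧
    -- whether an invertible rational matrix is an isomorphism from `G_A` to `G_B`
    (∃ f : List (List ℤ) × List (List ℤ) × List (List (ℤ × ℕ)) → Bool, Computable f ∧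
      ∀ (n : ℕ) (A B : Matrix (Fin n) (Fin n) ℤ) (hA : A.det ≠ 0) (hB : B.det ≠ 0)
        (T : GL (Fin n) ℚ),
        f (SolenoidGroup.intMatCode A, SolenoidGroup.intMatCode B,
            SolenoidGroup.ratMatCode (T : Matrix (Fin n) (Fin n) ℚ)) = true ↔
          SolenoidGroup.IsIso A B hA hB (T : Matrix (Fin n) (Fin n) ℚ)) := by
  obtain ⟨hom, hhom, hhom'⟩ := SolenoidGroup.exists_computable_isHom
  obtain ⟨iso, hiso, hiso'⟩ := SolenoidGroup.exists_computable_isIso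
  have hdup : Computable fun a : List (List ℤ) × List (List (ℤ × ℕ)) => (a.1, a.1, a.2) :=
    Computable.fst.pair (Computable.fst.pair Computable.snd)
  exact ⟨SolenoidGroup.exists_computable_mem,
    ⟨fun a => hom (a.1, a.1, a.2), hhom.comp hdup, fun n A hA T => hhom' n A A hA hA T⟩,
    ⟨fun a => iso (a.1, a.1, a.2), hiso.comp hdup, fun n A hA T => hiso' n A A hA hA T⟩,
    ⟨hom, hhom, hhom'⟩,
    ⟨iso, hiso, fun n A B hA hB T => hiso' n A B hA hB T⟩⟩
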